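/- Let $\mathbb K$ be a field of characteristic $0$ and let $\mathcal{C}om$ be the operad of non-unital commutative algebras: $\mathcal{C}om(0)=0$ and $\mathcal{C}om(n)=\mathbb K$, in degree $0$, for $n\ge 1$. Let $\mathcal B(\mathcal{C}om)$ be its bar construction, spanned by rooted trees all of whose vertices have at least two inputs, each vertex carrying a suspended (degree $1$) generator of $\mathcal{C}om$; its differential contracts internal edges. Let $\pi:\mathcal B(\mathcal{C}om)\to\mathcal{C}om$ be the universal twisting morphism (desuspension of trees with one vertex). Put $$L_{\mathcal{C}om}=\mathcal{C}om\circ_{(1)}\bigl(\mathcal B(\mathcal{C}om)\circ\mathcal{C}om\bigr),\qquad d=d_{\mathcal B(\mathcal{C}om)}-\delta^l+\delta^r,$$ where $\delta^l$ splits off the root vertex of the tree, applies $\pi$ to it and composes it with the lower level $\mathcal{C}om$, and $\delta^r$ splits off top vertices, applies $\pi$ to them and composes them with the upper level $\mathcal{C}om$. Let $\Omega_{\mathcal{C}om}$ be the module of Kähler differential forms of the operad, the quotient of $\mathcal{C}om\circ_{(1)}\mathcal{C}om$ by the Leibniz relations. Put $$\overline L_{\mathcal{C}om}=L_{\mathcal{C}om}\circ_{\mathcal{C}om}I,\qquad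 \overline\Omega_{\mathcal{C}om}=\Omega_{\mathcal{C}om}\circ_{\mathcal{C}om}I,\qquad O_{\mathcal{C}om}=\ker\bigl(\overline L_{\mathcal{C}om}\twoheadrightarrow\overline\Omega_{\mathcal{C}om}\bigr),$$ the last map being induced by the augmentation of $\mathcal B(\mathcal{C}om)$; $O_{\mathcal{C}om}$ is the module of obstructions of $\mathcal{C}om$. Let $\mu\in\mathcal{C}om(2)$ be the product and let $\nu\in\mathcal B(\mathcal{C}om)(2)$ be its suspension, the tree with one binary vertex. Let $\mu\otimes(\nu\otimes\mathrm{id})$ be the element of arity $3$ and degree $1$ of $O_{\mathcal{C}om}$ in which the inputs of $\nu$ are the first two variables, and the inputs of $\mu$ are the output of $\nu$ and the third variable. Then: 1. $\mu\otimes(\nu\otimes\mathrm{id})$ is a cycle of $O_{\mathcal{C}om}$; 2. $\mu\otimes(\nu\otimes\mathrm{id})$ is not a boundary in $O_{\mathcal{C}om}$; 3. hence $\mathrm H_1(O_{\mathcal{C}om})\neq 0$, already in arity $3$, so $O_{\mathcal{C}om}$ is not acyclic; 4. there is a commutative (non-unital) $\mathbb K$-algebra $A$ whose André–Quillen cohomology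 is not an Ext-functor over the enveloping algebra $A\otimes^{\mathcal{C}om}\mathbb K=\mathbb K\oplus A$. That is: $A$ has a cofibrant resolution $R\to A$ by a commutative differential graded algebra, and for every such resolution, with cotangent complex $\mathbb L_{R/A}=(\mathbb K\oplus A)\otimes_R\Omega_R$ and $\mathrm H^n_{\mathcal{C}om}(A,M)=\mathrm{Hom}_{D(\mathbb K\oplus A)}(\mathbb L_{R/A},M[n])$, the canonical comparison maps $$\mathrm{Ext}^n_{\mathbb K\oplus A}(\Omega_A,M)\longrightarrow\mathrm H^n_{\mathcal{C}om}(A,M),$$ induced by $\mathbb L_{R/A}\to\Omega_A$, are not isomorphisms for all $(\mathbb K\oplus A)$-modules $M$ and all $n\ge 0$. -/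

import Mathlib

open CategoryTheory
open scoped TensorProduct

universe u

set_option linter.unusedSectionVars false

namespace ComObstruction

/-- A reduced rooted tree with leaf set `Y`, all of whose vertices have at least two inputs, is
encoded by the set `T` of its vertices, a vertex being recorded as the set of leaves above it.
The sets `T` that occur are the laminar families of subsets of `Y` with at least two elements that
contain the root `Y`; for a one-element `Y` the only tree is the trivial one, without vertices. -/
structure IsTree {ι : Type*} (Y : Finset ι) (T : Set (Finset ι)) : Prop where
  nonempty : Y.Nonempty
  subset : ∀ A ∈ T, A ⊆ Y
  two_le : ∀ A ∈ T, 2 ≤ A.card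
  nested : ∀ A ∈ T, ∀ B ∈ T, A ⊆ B ∨ B ⊆ A ∨ Disjoint A B
  root : 2 ≤ Y.card → Y ∈ T

/-- A set of pairwise disjoint non-empty subsets of `X`, that is, a partition of a subset of `X`. -/
structure IsPartialPartition {X : Type*} (π : Finset (Finset X)) : Prop where
  nonempty : ∀ b ∈ π, b.Nonempty
  disjoint : ∀ b ∈ π, ∀ c ∈ π, b ≠ c → Disjoint b c

/-- The component of weight `k` of `B(Com)(Y)`, the bar construction of the operad `Com`, for a
finite set `Y`: the cofree cooperad on the suspension of the augmentation ideal of `Com`. It is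
spanned by the trees on `Y` with `k` vertices; each vertex carries a corolla of `Com` suspended to
degree `1`, so that `k` is also the homological degree, and a tree comes with an ordering
of its vertices, up to the sign of a reordering. An element is given by its coordinates:
`f v` is the coefficient at the tree with vertices `v 0, …, v (k - 1)`, in this order, so that `f` is
alternating in `v` and supported on the injective enumerations of trees. -/
def BarCom (K : Type*) [Field K] {ι : Type*} (Y : Finset ι) (k : ℕ) :
    Submodule K ((Fin k → Finset ι) → K) where
  carrier := {f | (∀ v, f v ≠ 0 → Function.Injective v ∧ IsTree Y (Set.range v)) ∧
    ∀ (σ : Equiv.Perm (Fin k)) v, f (v ∘ σ) = ((Equiv.Perm.sign σ : ℤ) : K) * f v}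
  zero_mem' := ⟨fun v h => absurd rfl h, fun σ v => by simp⟩
  add_mem' := by
    rintro f g ⟨hf, hf'⟩ ⟨hg, hg'⟩
    refine ⟨fun v h => ?_, fun σ v => by simp [hf', hg', mul_add]⟩
    by_cases h0 : f v = 0
    · exact hg v (by simpa [h0] using h)
    · exact hf v h0
  smul_mem' := by
    rintro c f ⟨hf, hf'⟩
    refine ⟨fun v h => hf v fun h0 => h (by simp [h0]), fun σ v => ?_⟩
    simp only [Pi.smul_apply, smul_eq_mul, hf']
    ring

/-- The component of weight (and degree) `k` of `L_Com(X) = (Com ∘_(1) (B(Com) ∘ Com))(X)`.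
A basis element consists of a partition `π` of a subset of `X`, whose blocks are the inputs of the
corollas of the upper level `Com`, an oriented tree with leaf set `π` in the middle, and the corolla
of the lower level `Com`, whose inputs are the root of the middle tree and the elements of `X` that lie
in no block of `π`. Since `Com(n)` is one-dimensional the corollas carry no other data, and they have
degree `0`. The coefficient of an element `F` at the basis element `(π, v)` is `F π v`. -/
def LCom (K : Type*) [Field K] (X : Type*) (k : ℕ) :
    Submodule K (Finset (Finset X) → (Fin k → Finset (Finset X)) → K) where
  carrier := {F | (∀ π, ¬ IsPartialPartition π → F π = 0) ∧ ∀ π, F π ∈ BarCom K π k}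
  zero_mem' := ⟨fun _ _ => rfl, fun π => (BarCom K π k).zero_mem⟩
  add_mem' := by
    rintro F G ⟨hF, hF'⟩ ⟨hG, hG'⟩
    exact ⟨fun π h => by simp [hF π h, hG π h], fun π => (BarCom K π k).add_mem (hF' π) (hG' π)⟩
  smul_mem' := by
    rintro c F ⟨hF, hF'⟩
    exact ⟨fun π h => by simp [hF π h], fun π => (BarCom K π k).smul_mem c (hF' π)⟩

section Differential

variable (K : Type*) [Field K] {X : Type*} [Fintype X] [DecidableEq X]

/-- The pair `(π, v)` indexes a basis element of `L_Com(X)`. -/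
def IsLevelTree {X : Type*} {k : ℕ} (π : Finset (Finset X)) (v : Fin k → Finset (Finset X)) :
    Prop :=
  IsPartialPartition π ∧ Function.Injective v ∧ IsTree π (Set.range v)

/-- Effect on a set `A` of blocks of replacing, if present, the block that is the union of the
members of `D` by the members of `D`. -/
def expand (D A : Finset (Finset X)) : Finset (Finset X) :=
  if D.sup id ∈ A then A.erase (D.sup id) ∪ D else A

/-- The differential of `B(Com)`, as the transpose of edge contraction. The edges of a tree with root
`Y` are in bijection with its vertices `A ≠ Y`; contracting the edge below `A` composes the corollas
at its two ends in `Com` and so deletes `A` from the set of vertices. The sign comes from moving `A`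
to the front and composing the suspended corollas. -/
def barD {ι : Type*} [DecidableEq ι] (Y : Finset ι) (k : ℕ) :
    ((Fin (k + 1) → Finset ι) → K) →ₗ[K] ((Fin k → Finset ι) → K) where
  toFun f v := -∑ A ∈ Y.ssubsets, f (Fin.cons A v)
  map_add' f g := by ext v; simp [Finset.sum_add_distrib]; ring
  map_smul' c f := by ext v; simp [Finset.mul_sum]

open Classical in
/-- The part of the differential of `L_Com` that is obtained by splitting off the root corolla of the
middle tree, projecting it by the twisting morphism `B(Com) → Com` (desuspension of trees with one
vertex) and composing it with the lower corolla. The other branches above this vertex have to be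
trivial trees, since all but one factor of the lower level lie in `Com`. On coordinates at
`(π, v)` this is the sum over the trees with root `ρ ⊋ π` that have `(π, v)` as a branch.
It covers also the case where the root is the only vertex: then `π` is a single block of `ρ`. -/
noncomputable def deltaL (k : ℕ) :
    (Finset (Finset X) → (Fin (k + 1) → Finset (Finset X)) → K) →ₗ[K]
      (Finset (Finset X) → (Fin k → Finset (Finset X)) → K) where
  toFun F π v := if IsLevelTree π v then
      ∑ ρ : Finset (Finset X) with π ⊂ ρ, F ρ (Fin.cons ρ v) else 0
  map_add' F G := by ext π v; by_cases h : IsLevelTree π v <;> simp [h, Finset.sum_add_distrib]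
  map_smul' c F := by ext π v; by_cases h : IsLevelTree π v <;> simp [h, Finset.mul_sum]

open Classical in
/-- The part of the differential of `L_Com` that is obtained by splitting off a top vertex of the
middle tree (one all of whose inputs are leaves), projecting it by the twisting morphism
`B(Com) → Com` and composing it with the corollas of `Com` above it: the blocks in the set `D` of
inputs of this vertex are merged into one block. On coordinates at `(π, v)` this is the sum over all
ways to cut a block of `π` into at least two blocks and to add the vertex that joins them. -/
noncomputable def deltaR (k : ℕ) :
    (Finset (Finset X) → (Fin (k + 1) → Finset (Finset X)) → K) →ₗ[K]
      (Finset (Finset X) → (Fin k → Finset (Finset X)) → K) where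
  toFun F π v := if IsLevelTree π v then
      ∑ D : Finset (Finset X) with 2 ≤ D.card ∧ D.sup id ∈ π,
        F (expand D π) (Fin.cons D fun i => expand D (v i)) else 0
  map_add' F G := by ext π v; by_cases h : IsLevelTree π v <;> simp [h, Finset.sum_add_distrib]
  map_smul' c F := by ext π v; by_cases h : IsLevelTree π v <;> simp [h, Finset.mul_sum]

variable {K}

theorem BarCom.cons_perm {ι : Type*} {Y : Finset ι} {k : ℕ} {f : (Fin (k + 1) → Finset ι) → K}
    (hf : f ∈ BarCom K Y (k + 1)) (A : Finset ι) (v : Fin k → Finset ι)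
    (σ : Equiv.Perm (Fin k)) :
    f (Fin.cons A (v ∘ σ)) = ((Equiv.Perm.sign σ : ℤ) : K) * f (Fin.cons A v) := by
  have h : (Fin.cons A (v ∘ σ) : Fin (k + 1) → Finset ι) =
      (Fin.cons A v : Fin (k + 1) → Finset ι) ∘ Equiv.Perm.decomposeFin.symm (0, σ) := by
    funext i
    refine Fin.cases ?_ (fun j => ?_) i <;> simp
  rw [h, hf.2, Equiv.Perm.decomposeFin.symm_sign]
  simp

theorem barD_mem {ι : Type*} [DecidableEq ι] {Y : Finset ι} {k : ℕ}
    {f : (Fin (k + 1) → Finset ι) → K} (hf : f ∈ BarCom K Y (k + 1)) :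
    barD K Y k f ∈ BarCom K Y k := by
  refine ⟨fun v h => ?_, fun σ v => ?_⟩
  · obtain ⟨A, hA, hAv⟩ := Finset.exists_ne_zero_of_sum_ne_zero (neg_ne_zero.1 h)
    obtain ⟨hi, ht⟩ := hf.1 _ hAv
    rw [Fin.cons_injective_iff] at hi
    rw [Fin.range_cons] at ht
    exact ⟨hi.2, ht.nonempty, fun B hB => ht.subset B (.inr hB), fun B hB => ht.two_le B (.inr hB),
      fun B hB C hC => ht.nested B (.inr hB) C (.inr hC), fun h2 =>
        (ht.root h2).resolve_left (Finset.mem_ssubsets.1 hA).ne'⟩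
  · simp [barD, BarCom.cons_perm hf, Finset.mul_sum]

theorem isLevelTree_comp {X : Type*} {k : ℕ} (π : Finset (Finset X))
    (v : Fin k → Finset (Finset X)) (σ : Equiv.Perm (Fin k)) :
    IsLevelTree π (v ∘ σ) ↔ IsLevelTree π v := by
  simp [IsLevelTree, Set.range_comp]

theorem deltaL_mem {k : ℕ} {F : Finset (Finset X) → (Fin (k + 1) → Finset (Finset X)) → K}
    (hF : F ∈ LCom K X (k + 1)) : deltaL K k F ∈ LCom K X k := by
  refine ⟨fun π h => ?_, fun π => ⟨fun v h => ?_, fun σ v => ?_⟩⟩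
  · ext v
    simp [deltaL, IsLevelTree, h]
  · by_contra hc
    simp [deltaL, IsLevelTree, hc] at h
  · simp only [deltaL, LinearMap.coe_mk, AddHom.coe_mk,
      fun ρ => BarCom.cons_perm (hF.2 ρ), ← Finset.mul_sum, mul_ite, mul_zero]
    by_cases hl : IsLevelTree π v
    · rw [if_pos hl, if_pos ((isLevelTree_comp π v σ).2 hl)]
    · rw [if_neg hl, if_neg fun h => hl ((isLevelTree_comp π v σ).1 h)]

theorem deltaR_mem {k : ℕ} {F : Finset (Finset X) → (Fin (k + 1) → Finset (Finset X)) → K}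
    (hF : F ∈ LCom K X (k + 1)) : deltaR K k F ∈ LCom K X k := by
  refine ⟨fun π h => ?_, fun π => ⟨fun v h => ?_, fun σ v => ?_⟩⟩
  · ext v
    simp [deltaR, IsLevelTree, h]
  · by_contra hc
    simp [deltaR, IsLevelTree, hc] at h
  · have (D : Finset (Finset X)) : (fun i => expand D ((v ∘ σ) i)) =
      (fun i => expand D (v i)) ∘ σ := rfl
    simp only [deltaR, LinearMap.coe_mk, AddHom.coe_mk, this,
      fun D => BarCom.cons_perm (hF.2 (expand D π)), ← Finset.mul_sum, mul_ite, mul_zero]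
    by_cases hl : IsLevelTree π v
    · rw [if_pos hl, if_pos ((isLevelTree_comp π v σ).2 hl)]
    · rw [if_neg hl, if_neg fun h => hl ((isLevelTree_comp π v σ).1 h)]

variable (K X) in
/-- The differential of `L_Com`: the differential of `B(Com)`, twisted on both sides by the universal
twisting morphism `B(Com) → Com`. -/
noncomputable def LCom.d (k : ℕ) : LCom K X (k + 1) →ₗ[K] LCom K X k :=
  ((LinearMap.pi fun π => barD K π k ∘ₗ LinearMap.proj π) - deltaL K k + deltaR K k).restrict
    fun F hF => by
      refine (LCom K X k).add_mem ((LCom K X k).sub_mem ⟨fun π h => ?_, fun π => ?_⟩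
        (deltaL_mem hF)) (deltaR_mem hF)
      · simp [hF.1 π h]
      · exact barD_mem (hF.2 π)

section
variable {Z : Type*} [Fintype Z] [DecidableEq Z]

/-- The preimage of a finite set. -/
def preimage (f : X → Z) (b : Finset Z) : Finset X := {x | f x ∈ b}

/-- The preimages of the members of a set of finite sets. -/
def preimages (f : X → Z) (A : Finset (Finset Z)) : Finset (Finset X) := A.image (preimage f)

variable (K) in
/-- The right action of `Com` on coordinates: see `LCom.rho`. -/
def rhoRaw (f : X → Z) (k : ℕ) :
    (Finset (Finset Z) → (Fin k → Finset (Finset Z)) → K) →ₗ[K]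
      (Finset (Finset X) → (Fin k → Finset (Finset X)) → K) where
  toFun F π v := ∑ ρ : Finset (Finset Z), ∑ w : Fin k → Finset (Finset Z),
    if preimages f ρ = π ∧ (fun i => preimages f (w i)) = v then F ρ w else 0
  map_add' F G := by
    ext π v
    simp only [Pi.add_apply, ← Finset.sum_add_distrib]
    refine Finset.sum_congr rfl fun ρ _ => Finset.sum_congr rfl fun w _ => ?_
    split_ifs <;> simp
  map_smul' c F := by
    ext π v
    simp only [Pi.smul_apply, smul_eq_mul, RingHom.id_apply, Finset.mul_sum, mul_ite, mul_zero]

section Lemmas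

theorem preimage_injective {f : X → Z} (hf : Function.Surjective f) : Function.Injective (preimage f) := by
  intro b c h
  ext z
  obtain ⟨x, rfl⟩ := hf z
  simpa [preimage] using Finset.ext_iff.1 h x

theorem preimages_injective {f : X → Z} (hf : Function.Surjective f) : Function.Injective (preimages f) :=
  Finset.image_injective (preimage_injective hf)

theorem preimage_nonempty {f : X → Z} (hf : Function.Surjective f) (b : Finset Z) : (preimage f b).Nonempty ↔ b.Nonempty := by
  constructor
  · rintro ⟨x, hx⟩
    exact ⟨f x, by simpa [preimage] using hx⟩
  · rintro ⟨z, hz⟩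
    obtain ⟨x, rfl⟩ := hf z
    exact ⟨x, by simpa [preimage] using hz⟩

theorem preimage_disjoint {f : X → Z} (hf : Function.Surjective f) (b c : Finset Z) :
    Disjoint (preimage f b) (preimage f c) ↔ Disjoint b c := by
  simp only [Finset.disjoint_left, preimage, Finset.mem_filter, Finset.mem_univ, true_and]
  exact ⟨fun h z hz => by obtain ⟨x, rfl⟩ := hf z; exact h hz, fun h x hx => h hx⟩

theorem isPartialPartition_preimages {f : X → Z} (hf : Function.Surjective f) (π : Finset (Finset Z)) :
    IsPartialPartition (preimages f π) ↔ IsPartialPartition π := by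
  have hi := preimage_injective hf
  constructor
  · intro h
    refine ⟨fun b (hb : b ∈ π) => (preimage_nonempty hf b).1 (h.nonempty (preimage f b) (Finset.mem_image_of_mem (preimage f) hb)),
      fun b (hb : b ∈ π) c (hc : c ∈ π) hbc => (preimage_disjoint hf b c).1 (h.disjoint (preimage f b)
        (Finset.mem_image_of_mem (preimage f) hb) (preimage f c)
        (Finset.mem_image_of_mem (preimage f) hc) (hi.ne hbc))⟩
  · intro h
    refine ⟨fun b' hb => ?_, fun b' hb c' hc hbc => ?_⟩
    · obtain ⟨b, hb1, rfl⟩ := Finset.mem_image.1 hb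
      exact (preimage_nonempty hf b).2 (h.nonempty _ hb1)
    · obtain ⟨b, hb1, rfl⟩ := Finset.mem_image.1 hb
      obtain ⟨c, hc1, rfl⟩ := Finset.mem_image.1 hc
      exact (preimage_disjoint hf b c).2 (h.disjoint _ hb1 _ hc1 fun h => hbc (h ▸ rfl))

theorem isTree_preimages {f : X → Z} (hf : Function.Surjective f) (π : Finset (Finset Z)) (T : Set (Finset (Finset Z))) :
    IsTree (preimages f π) (preimages f '' T) ↔ IsTree π T := by
  have hi := preimage_injective hf
  have hc : ∀ A : Finset (Finset Z), (preimages f A).card = A.card :=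
    fun A => Finset.card_image_of_injective _ hi
  have hs : ∀ A B : Finset (Finset Z), preimages f A ⊆ preimages f B ↔ A ⊆ B :=
    fun A B => Finset.image_subset_image_iff hi
  have hd : ∀ A B : Finset (Finset Z), Disjoint (preimages f A) (preimages f B) ↔ Disjoint A B :=
    fun A B => Finset.disjoint_image hi
  constructor
  · intro h
    refine ⟨Finset.image_nonempty.1 h.nonempty, fun A hA => (hs _ _).1 (h.subset _ ⟨A, hA, rfl⟩),
      fun A hA => hc A ▸ h.two_le _ ⟨A, hA, rfl⟩, fun A hA B hB => ?_, fun h2 => ?_⟩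
    · simpa only [hs, hd] using h.nested _ ⟨A, hA, rfl⟩ _ ⟨B, hB, rfl⟩
    · obtain ⟨A, hA, e⟩ := h.root (by rwa [hc])
      exact preimages_injective hf e ▸ hA
  · intro h
    refine ⟨Finset.image_nonempty.2 h.nonempty, ?_, ?_, ?_, fun h2 => ⟨π, h.root (hc π ▸ h2), rfl⟩⟩
    · rintro _ ⟨A, hA, rfl⟩
      exact (hs _ _).2 (h.subset _ hA)
    · rintro _ ⟨A, hA, rfl⟩
      exact hc A ▸ h.two_le _ hA
    · rintro _ ⟨A, hA, rfl⟩ _ ⟨B, hB, rfl⟩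
      simpa only [hs, hd] using h.nested _ hA _ hB

theorem isLevelTree_preimages {f : X → Z} (hf : Function.Surjective f) {k : ℕ} (π : Finset (Finset Z)) (w : Fin k → Finset (Finset Z)) :
    IsLevelTree (preimages f π) (fun i => preimages f (w i)) ↔ IsLevelTree π w := by
  have : (fun i => preimages f (w i)) = preimages f ∘ w := rfl
  rw [IsLevelTree, IsLevelTree, this, Set.range_comp, isTree_preimages hf,
    isPartialPartition_preimages hf, (preimages_injective hf).of_comp_iff]

theorem rhoRaw_preimages {f : X → Z} (hf : Function.Surjective f) {k : ℕ}
    (F : Finset (Finset Z) → (Fin k → Finset (Finset Z)) → K) (π : Finset (Finset Z)) (w : Fin k → Finset (Finset Z)) :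
    rhoRaw K f k F (preimages f π) (fun i => preimages f (w i)) = F π w := by
  have h2 : ∀ w' : Fin k → Finset (Finset Z),
      ((fun i => preimages f (w' i)) = fun i => preimages f (w i)) ↔ w' = w := fun w' =>
    (preimages_injective hf).comp_left.eq_iff (a := w') (b := w)
  simp only [rhoRaw, LinearMap.coe_mk, AddHom.coe_mk, (preimages_injective hf).eq_iff, h2]
  rw [Finset.sum_eq_single π, Finset.sum_eq_single w] <;> simp +contextual

end Lemmas

theorem exists_of_rhoRaw_ne_zero {f : X → Z} {k : ℕ}
    {F : Finset (Finset Z) → (Fin k → Finset (Finset Z)) → K}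
    {π : Finset (Finset X)} {v : Fin k → Finset (Finset X)} (h : rhoRaw K f k F π v ≠ 0) :
    ∃ (ρ : Finset (Finset Z)) (w : Fin k → Finset (Finset Z)), π = preimages f ρ ∧ v = (fun i => preimages f (w i)) ∧ F ρ w ≠ 0 := by
  obtain ⟨ρ, -, h⟩ := Finset.exists_ne_zero_of_sum_ne_zero h
  obtain ⟨w, -, h⟩ := Finset.exists_ne_zero_of_sum_ne_zero h
  rw [ite_ne_right_iff] at h
  exact ⟨ρ, w, h.1.1.symm, h.1.2.symm, h.2⟩

theorem preimages_cons {f : X → Z} {k : ℕ} (A : Finset (Finset Z)) (w : Fin k → Finset (Finset Z)) :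
    (Fin.cons (preimages f A) fun i => preimages f (w i) : Fin (k + 1) → Finset (Finset X)) =
      fun i => preimages f ((Fin.cons A w : Fin (k + 1) → Finset (Finset Z)) i) := by
  funext i
  refine Fin.cases ?_ (fun j => ?_) i <;> simp

theorem exists_of_cons_eq {f : X → Z} {k : ℕ} {A : Finset (Finset X)}
    {v : Fin k → Finset (Finset X)} {w : Fin (k + 1) → Finset (Finset Z)}
    (h : (Fin.cons A v : Fin (k + 1) → Finset (Finset X)) = fun i => preimages f (w i)) :
    A = preimages f (w 0) ∧ v = fun i => preimages f (w i.succ) := by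
  constructor
  · simpa using congrFun h 0
  · funext i
    simpa using congrFun h i.succ

theorem rhoRaw_mem {f : X → Z} (hf : Function.Surjective f) {k : ℕ}
    {F : Finset (Finset Z) → (Fin k → Finset (Finset Z)) → K} (hF : F ∈ LCom K Z k) :
    rhoRaw K f k F ∈ LCom K X k := by
  refine ⟨fun π h => ?_, fun π => ⟨fun v h => ?_, fun σ v => ?_⟩⟩
  · funext v
    by_contra hc
    obtain ⟨ρ, w, rfl, rfl, h0⟩ := exists_of_rhoRaw_ne_zero hc
    rw [isPartialPartition_preimages hf] at h
    exact h0 (by simp [hF.1 ρ h])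
  · obtain ⟨ρ, w, rfl, rfl, h0⟩ := exists_of_rhoRaw_ne_zero h
    have hl : IsLevelTree ρ w :=
      ⟨by by_contra hc; exact h0 (by simp [hF.1 ρ hc]), (hF.2 ρ).1 w h0⟩
    exact ((isLevelTree_preimages hf ρ w).2 hl).2
  · by_cases hc : ∃ (ρ : Finset (Finset Z)) (w : Fin k → Finset (Finset Z)), π = preimages f ρ ∧ v = (fun i => preimages f (w i))
    · obtain ⟨ρ, w, rfl, rfl⟩ := hc
      rw [rhoRaw_preimages hf, ← (hF.2 ρ).2, ← rhoRaw_preimages hf F ρ (w ∘ σ)]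
      rfl
    · have h1 : rhoRaw K f k F π v = 0 := by
        by_contra h
        obtain ⟨ρ, w, h1, h2, -⟩ := exists_of_rhoRaw_ne_zero h
        exact hc ⟨ρ, w, h1, h2⟩
      have h2 : rhoRaw K f k F π (v ∘ σ) = 0 := by
        by_contra h
        obtain ⟨ρ, w, h1, h2, -⟩ := exists_of_rhoRaw_ne_zero h
        refine hc ⟨ρ, w ∘ σ.symm, h1, ?_⟩
        funext i
        simpa using congrFun h2 (σ.symm i)
      rw [h1, h2, mul_zero]

theorem preimages_subset {f : X → Z} {A : Finset (Finset X)} {ρ : Finset (Finset Z)}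
    (h : A ⊆ preimages f ρ) : ∃ B, A = preimages f B := by
  obtain ⟨B, -, hB⟩ := Finset.subset_image_iff.1 h
  exact ⟨B, hB.symm⟩

theorem preimage_sup {f : X → Z} (D : Finset (Finset Z)) :
    (preimages f D).sup id = preimage f (D.sup id) := by
  ext x
  simp [preimages, preimage, Finset.mem_sup]

theorem preimages_expand {f : X → Z} (hf : Function.Surjective f) (D A : Finset (Finset Z)) :
    expand (preimages f D) (preimages f A) = preimages f (expand D A) := by
  have hi := preimage_injective hf
  have hm : preimage f (D.sup id) ∈ preimages f A ↔ D.sup id ∈ A := hi.mem_finset_image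
  unfold expand
  rw [preimage_sup]
  by_cases h : D.sup id ∈ A
  · rw [if_pos h, if_pos (hm.2 h)]
    simp only [preimages, Finset.image_union, Finset.image_erase hi]
  · rw [if_neg h, if_neg (fun h' => h (hm.1 h'))]

theorem barD_rhoRaw {f : X → Z} (hf : Function.Surjective f) (k : ℕ)
    (F : Finset (Finset Z) → (Fin (k + 1) → Finset (Finset Z)) → K) (π : Finset (Finset X))
    (v : Fin k → Finset (Finset X)) :
    barD K π k (rhoRaw K f (k + 1) F π) v =
      rhoRaw K f k (fun ρ => barD K ρ k (F ρ)) π v := by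
  by_cases hc : ∃ (ρ : Finset (Finset Z)) (w : Fin k → Finset (Finset Z)), π = preimages f ρ ∧ v = (fun i => preimages f (w i))
  · obtain ⟨ρ, w, rfl, rfl⟩ := hc
    rw [rhoRaw_preimages hf]
    simp only [barD, LinearMap.coe_mk, AddHom.coe_mk, neg_inj]
    symm
    refine Finset.sum_of_injOn (preimages f) (preimages_injective hf).injOn ?_ ?_ ?_
    · intro A hA
      rw [Finset.mem_coe, Finset.mem_ssubsets] at hA ⊢
      exact (Finset.image_ssubset_image (preimage_injective hf)).2 hA
    · intro A' hA' hn
      by_contra h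
      obtain ⟨ρ', w', h1, h2, h3⟩ := exists_of_rhoRaw_ne_zero h
      obtain ⟨h4, -⟩ := exists_of_cons_eq h2
      refine hn ⟨w' 0, ?_, h4.symm⟩
      rw [h4, Finset.mem_ssubsets] at hA'
      exact Finset.mem_coe.2 (Finset.mem_ssubsets.2
        ((Finset.image_ssubset_image (preimage_injective hf)).1 hA'))
    · intro A hA
      rw [preimages_cons, rhoRaw_preimages hf]
  · have h1 : rhoRaw K f k (fun ρ => barD K ρ k (F ρ)) π v = 0 := by
      by_contra h
      obtain ⟨ρ, w, h1, h2, -⟩ := exists_of_rhoRaw_ne_zero h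
      exact hc ⟨ρ, w, h1, h2⟩
    rw [h1]
    by_contra h
    obtain ⟨A, hA, hAv⟩ := Finset.exists_ne_zero_of_sum_ne_zero (neg_ne_zero.1 h)
    obtain ⟨ρ, w, h1, h2, -⟩ := exists_of_rhoRaw_ne_zero hAv
    exact hc ⟨ρ, _, h1, (exists_of_cons_eq h2).2⟩

theorem deltaL_rhoRaw {f : X → Z} (hf : Function.Surjective f) (k : ℕ)
    (F : Finset (Finset Z) → (Fin (k + 1) → Finset (Finset Z)) → K) :
    deltaL K k (rhoRaw K f (k + 1) F) = rhoRaw K f k (deltaL K k F) := by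
  funext π v
  by_cases hc : ∃ (ρ : Finset (Finset Z)) (w : Fin k → Finset (Finset Z)), π = preimages f ρ ∧ v = (fun i => preimages f (w i))
  · obtain ⟨π, w, rfl, rfl⟩ := hc
    rw [rhoRaw_preimages hf]
    simp only [deltaL, LinearMap.coe_mk, AddHom.coe_mk]
    by_cases hl : IsLevelTree π w
    swap
    · rw [if_neg hl, if_neg fun h => hl ((isLevelTree_preimages hf π w).1 h)]
    rw [if_pos hl, if_pos ((isLevelTree_preimages hf π w).2 hl)]
    symm
    refine Finset.sum_of_injOn (preimages f) (preimages_injective hf).injOn ?_ ?_ ?_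
    · intro A hA
      simp only [Finset.coe_filter, Finset.mem_univ, true_and, Set.mem_ofPred_eq] at hA ⊢
      exact (Finset.image_ssubset_image (preimage_injective hf)).2 hA
    · intro A' hA' hn
      by_contra h
      obtain ⟨ρ', w', h1, h2, h3⟩ := exists_of_rhoRaw_ne_zero h
      refine hn ⟨ρ', ?_, h1.symm⟩
      rw [h1, Finset.mem_filter] at hA'
      simpa using (Finset.image_ssubset_image (preimage_injective hf)).1 hA'.2
    · intro A hA
      rw [preimages_cons, rhoRaw_preimages hf]
  · have h1 : rhoRaw K f k (deltaL K k F) π v = 0 := by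
      by_contra h
      obtain ⟨ρ, w, h1, h2, -⟩ := exists_of_rhoRaw_ne_zero h
      exact hc ⟨ρ, w, h1, h2⟩
    rw [h1]
    by_contra h
    simp only [deltaL, LinearMap.coe_mk, AddHom.coe_mk, ite_eq_right_iff, not_forall] at h
    obtain ⟨-, h⟩ := h
    obtain ⟨A, hA, hAv⟩ := Finset.exists_ne_zero_of_sum_ne_zero h
    obtain ⟨ρ, w, h1, h2, -⟩ := exists_of_rhoRaw_ne_zero hAv
    rw [h1, Finset.mem_filter] at hA
    obtain ⟨B, hB⟩ := preimages_subset hA.2.subset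
    exact hc ⟨B, _, hB, (exists_of_cons_eq h2).2⟩

theorem expand_of_mem {D A : Finset (Finset X)} (h : D.sup id ∈ A) :
    expand D A = A.erase (D.sup id) ∪ D := if_pos h

theorem exists_of_expand {f : X → Z} {A D : Finset (Finset X)}
    {B E : Finset (Finset Z)}
    (h : expand D A = preimages f B) (hE : D = preimages f E) : ∃ C, A = preimages f C := by
  by_cases hm : D.sup id ∈ A
  · have h1 : A.erase (D.sup id) ⊆ preimages f B := by
      rw [← h, expand_of_mem hm]
      exact Finset.subset_union_left
    obtain ⟨C, hC⟩ := preimages_subset h1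
    refine ⟨insert (E.sup id) C, ?_⟩
    rw [preimages, Finset.image_insert, ← preimages, ← hC, ← preimage_sup, ← hE,
      Finset.insert_erase hm]
  · rw [expand, if_neg hm] at h
    exact ⟨B, h⟩

theorem deltaR_rhoRaw {f : X → Z} (hf : Function.Surjective f) (k : ℕ)
    (F : Finset (Finset Z) → (Fin (k + 1) → Finset (Finset Z)) → K) :
    deltaR K k (rhoRaw K f (k + 1) F) = rhoRaw K f k (deltaR K k F) := by
  have hi := preimage_injective hf
  have hc0 : ∀ D : Finset (Finset Z), (preimages f D).card = D.card :=
    fun D => Finset.card_image_of_injective _ hi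
  have hm : ∀ D π : Finset (Finset Z), (preimages f D).sup id ∈ preimages f π ↔ D.sup id ∈ π :=
    fun D π => by rw [preimage_sup]; exact hi.mem_finset_image
  funext π v
  by_cases hc : ∃ (ρ : Finset (Finset Z)) (w : Fin k → Finset (Finset Z)), π = preimages f ρ ∧ v = (fun i => preimages f (w i))
  · obtain ⟨π, w, rfl, rfl⟩ := hc
    rw [rhoRaw_preimages hf]
    simp only [deltaR, LinearMap.coe_mk, AddHom.coe_mk]
    by_cases hl : IsLevelTree π w
    swap
    · rw [if_neg hl, if_neg fun h => hl ((isLevelTree_preimages hf π w).1 h)]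
    rw [if_pos hl, if_pos ((isLevelTree_preimages hf π w).2 hl)]
    symm
    refine Finset.sum_of_injOn (preimages f) (preimages_injective hf).injOn ?_ ?_ ?_
    · intro D hD
      simp only [Finset.coe_filter, Finset.mem_univ, true_and, Set.mem_ofPred_eq, hc0, hm] at hD ⊢
      exact hD
    · intro D' hD' hn
      by_contra h
      obtain ⟨ρ', w', h1, h2, h3⟩ := exists_of_rhoRaw_ne_zero h
      obtain ⟨h4, -⟩ := exists_of_cons_eq h2
      refine hn ⟨w' 0, ?_, h4.symm⟩
      rw [h4, Finset.mem_filter, hc0, hm] at hD'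
      simpa using hD'.2
    · intro D hD
      simp only [preimages_expand hf]
      rw [preimages_cons, rhoRaw_preimages hf]
  · have h1 : rhoRaw K f k (deltaR K k F) π v = 0 := by
      by_contra h
      obtain ⟨ρ, w, h1, h2, -⟩ := exists_of_rhoRaw_ne_zero h
      exact hc ⟨ρ, w, h1, h2⟩
    rw [h1]
    by_contra h
    simp only [deltaR, LinearMap.coe_mk, AddHom.coe_mk, ite_eq_right_iff, not_forall] at h
    obtain ⟨hl, h⟩ := h
    obtain ⟨D, hD, hDv⟩ := Finset.exists_ne_zero_of_sum_ne_zero h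
    obtain ⟨ρ, w, h1, h2, -⟩ := exists_of_rhoRaw_ne_zero hDv
    obtain ⟨h3, h4⟩ := exists_of_cons_eq h2
    rw [Finset.mem_filter] at hD
    obtain ⟨B, hB⟩ := exists_of_expand h1 h3
    have hw : ∀ i, ∃ C, v i = preimages f C := fun i =>
      exists_of_expand (congrFun h4 i) h3
    choose C hC using hw
    exact hc ⟨B, C, hB, funext hC⟩

end
end Differential

section Quotients

variable (K : Type*) [Field K]

/-- The right action of `Com` on `L_Com`. A surjection `f : X → Z` is the same as a family of
corollas of `Com`, one for each element `z` of `Z`, with inputs `f ⁻¹ z`. Composing them with the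
inputs of a basis element on `Z` multiplies out in the upper and in the lower level `Com`, and so
replaces all sets of inputs by their preimages. -/
def LCom.rho {X Z : Type*} [Fintype X] [DecidableEq X] [Fintype Z] [DecidableEq Z]
    {f : X → Z} (hf : Function.Surjective f) (k : ℕ) : LCom K Z k →ₗ[K] LCom K X k :=
  (rhoRaw K f k).restrict fun _ hF => rhoRaw_mem hf hF

theorem LCom.d_rho {X Z : Type*} [Fintype X] [DecidableEq X] [Fintype Z] [DecidableEq Z]
    {f : X → Z} (hf : Function.Surjective f) (k : ℕ) (F : LCom K Z (k + 1)) :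
    LCom.d K X k (LCom.rho K hf (k + 1) F) = LCom.rho K hf k (LCom.d K Z k F) := by
  apply Subtype.ext
  change (fun π => barD K π k (rhoRaw K f (k + 1) F.1 π)) - deltaL K k (rhoRaw K f (k + 1) F.1) +
      deltaR K k (rhoRaw K f (k + 1) F.1) = rhoRaw K f k ((fun π => barD K π k (F.1 π)) -
      deltaL K k F.1 + deltaR K k F.1)
  rw [map_add, map_sub, deltaL_rhoRaw hf, deltaR_rhoRaw hf]
  congr 2
  funext π v
  exact barD_rhoRaw hf k F.1 π v

/-- The span of the images in `L_Com(n)` of the actions of non-trivial operations of `Com`, that is,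
the image of `L_Com ∘ Com⁺ → L_Com` for the augmentation ideal `Com⁺` of `Com`. -/
def LCom.decomposables (n k : ℕ) : Submodule K (LCom K (Fin n) k) :=
  ⨆ (m : ℕ) (f : Fin n → Fin m) (hf : Function.Surjective f) (_ : ¬ Function.Injective f),
    LinearMap.range (LCom.rho K hf k)

/-- `L_Com ∘_Com I` in arity `n` and degree `k`: the quotient of `L_Com` by the relations that
identify the right action of `Com` with its action on `I` through the augmentation. -/
abbrev LBar (n k : ℕ) : Type _ := LCom K (Fin n) k ⧸ LCom.decomposables K n k

theorem LCom.d_decomposables (n k : ℕ) :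
    LCom.decomposables K n (k + 1) ≤ (LCom.decomposables K n k).comap (LCom.d K (Fin n) k) := by
  refine iSup_le fun m => iSup_le fun f => iSup_le fun hf => iSup_le fun hn => ?_
  rintro _ ⟨F, rfl⟩
  rw [Submodule.mem_comap, LCom.d_rho]
  exact Submodule.mem_iSup_of_mem m (Submodule.mem_iSup_of_mem f (Submodule.mem_iSup_of_mem hf
    (Submodule.mem_iSup_of_mem hn ⟨_, rfl⟩)))

/-- The differential that `L_Com ∘_Com I` inherits from `L_Com`. -/
noncomputable def LBar.d (n k : ℕ) : LBar K n (k + 1) →ₗ[K] LBar K n k :=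
  Submodule.mapQ _ _ (LCom.d K (Fin n) k) (LCom.d_decomposables K n k)

/-- `(Com ∘_(1) Com)(X)`: the basis element of `B` is the operation
`(∏ x ∉ B, x) · d(∏ x ∈ B, x)`, a lower corolla with inputs the elements outside `B` and one upper
corolla, with inputs the elements of `B`. -/
abbrev ComCom (X : Type*) : Type _ := {B : Finset X // B.Nonempty} →₀ K

/-- The right action of `Com` on `Com ∘_(1) Com`. -/
noncomputable def ComCom.rho {X Z : Type*} [Fintype X] [DecidableEq X] [Fintype Z] [DecidableEq Z]
    {f : X → Z} (hf : Function.Surjective f) : ComCom K Z →ₗ[K] ComCom K X :=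
  Finsupp.lmapDomain K K fun B => ⟨preimage f B.1, (preimage_nonempty hf B.1).2 B.2⟩

/-- The Leibniz relation for a product of several factors, each of them a product of variables. -/
noncomputable def ComCom.leibnizElt {X : Type*} [DecidableEq X] (π : Finset (Finset X))
    (hπ : IsPartialPartition π) (h : π.Nonempty) : ComCom K X :=
  Finsupp.single ⟨π.sup id, by
    obtain ⟨b, hb⟩ := h
    exact (hπ.nonempty b hb).mono (Finset.le_sup (f := id) hb)⟩ 1 -
  ∑ b : π, Finsupp.single ⟨b.1, hπ.nonempty b.1 b.2⟩ 1

/-- The submodule of `Com ∘_(1) Com` generated by the Leibniz relations: its quotient is the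
module `Ω_Com` of Kähler differential forms, the coequalizer of the two maps from
`Com ∘_(1) (Com ∘ Com)`, one composing the two upper levels and one splitting the differential over
the factors of the middle level and composing it with the lower level. -/
noncomputable def ComCom.leibniz (X : Type*) [DecidableEq X] : Submodule K (ComCom K X) :=
  Submodule.span K {g | ∃ π hπ h, g = ComCom.leibnizElt K (X := X) π hπ h}

/-- The module `Ω_Com` of Kähler differential forms of the operad `Com`. -/
abbrev OmegaCom (X : Type*) [DecidableEq X] : Type _ := ComCom K X ⧸ ComCom.leibniz K X

/-- The image of the actions of non-trivial operations of `Com` on `Ω_Com`. -/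
noncomputable def OmegaCom.decomposables (n : ℕ) : Submodule K (OmegaCom K (Fin n)) :=
  ⨆ (m : ℕ) (f : Fin n → Fin m) (hf : Function.Surjective f) (_ : ¬ Function.Injective f),
    LinearMap.range ((ComCom.leibniz K (Fin n)).mkQ ∘ₗ ComCom.rho K hf)

/-- The quotient `Ω_Com ∘_Com I` in arity `n`; it is concentrated in degree `0`. -/
abbrev OmegaBar (n : ℕ) : Type _ := OmegaCom K (Fin n) ⧸ OmegaCom.decomposables K n

/-- The projection `Com ∘_(1) (B(Com) ∘ Com) → Com ∘_(1) Com` induced by the augmentation of `B(Com)`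
(on degree `0`; it vanishes on the other degrees). -/
noncomputable def LCom.proj (X : Type*) [Fintype X] [DecidableEq X] : LCom K X 0 →ₗ[K] ComCom K X :=
  ∑ b : {B : Finset X // B.Nonempty},
    Finsupp.lsingle b ∘ₗ LinearMap.proj ![] ∘ₗ LinearMap.proj {b.1} ∘ₗ (LCom K X 0).subtype

theorem LCom.proj_apply {X : Type*} [Fintype X] [DecidableEq X] (F : LCom K X 0)
    (b : {B : Finset X // B.Nonempty}) : LCom.proj K X F b = F.1 {b.1} ![] := by
  simp only [LCom.proj, LinearMap.sum_apply, Finsupp.finsetSum_apply]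
  rw [Finset.sum_eq_single b] <;> simp +contextual

theorem LCom.proj_rho {X Z : Type*} [Fintype X] [DecidableEq X] [Fintype Z] [DecidableEq Z]
    {f : X → Z} (hf : Function.Surjective f) (F : LCom K Z 0) :
    LCom.proj K X (LCom.rho K hf 0 F) = ComCom.rho K hf (LCom.proj K Z F) := by
  have hi : Function.Injective fun B : {B : Finset Z // B.Nonempty} =>
      (⟨preimage f B.1, (preimage_nonempty hf B.1).2 B.2⟩ : {B : Finset X // B.Nonempty}) :=
    fun B C h => Subtype.ext (preimage_injective hf (congrArg Subtype.val h))
  ext b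
  rw [LCom.proj_apply]
  change rhoRaw K f 0 F.1 {b.1} ![] = Finsupp.mapDomain _ _ b
  by_cases hb : ∃ c : {B : Finset Z // B.Nonempty}, preimage f c.1 = b.1
  · obtain ⟨c, hc⟩ := hb
    have hb' : b = (fun B : {B : Finset Z // B.Nonempty} =>
      (⟨preimage f B.1, (preimage_nonempty hf B.1).2 B.2⟩ : {B : Finset X // B.Nonempty})) c :=
      Subtype.ext hc.symm
    rw [hb', Finsupp.mapDomain_apply hi, LCom.proj_apply,
      ← rhoRaw_preimages hf F.1 {c.1} ![],
      Subsingleton.elim (fun i => preimages f ((![] : Fin 0 → Finset (Finset Z)) i)) ![]]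
    simp [preimages]
  · rw [Finsupp.mapDomain_of_notMem_range]
    · by_contra h
      obtain ⟨ρ, w, h1, -, h3⟩ := exists_of_rhoRaw_ne_zero h
      have hm : b.1 ∈ preimages f ρ := h1 ▸ Finset.mem_singleton_self _
      obtain ⟨c, -, hc⟩ := Finset.mem_image.1 hm
      exact hb ⟨⟨c, (preimage_nonempty hf c).1 (hc ▸ b.2)⟩, hc⟩
    · rintro ⟨c, hc⟩
      exact hb ⟨c, congrArg Subtype.val hc⟩

theorem ComCom.leibnizElt_apply {X : Type*} [DecidableEq X] (π : Finset (Finset X))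
    (hπ : IsPartialPartition π) (h : π.Nonempty) (b : {B : Finset X // B.Nonempty}) :
    ComCom.leibnizElt K π hπ h b = (if π.sup id = b.1 then 1 else 0) - if b.1 ∈ π then 1 else 0 := by
  rw [ComCom.leibnizElt, Finsupp.sub_apply, Finsupp.finsetSum_apply]
  congr 1
  · simp [Finsupp.single_apply, Subtype.ext_iff]
  · simp only [Finsupp.single_apply, Subtype.ext_iff]
    rw [Finset.sum_coe_sort π (fun i => if i = b.1 then (1 : K) else 0)]
    simp

open Classical in
theorem LCom.proj_d {X : Type*} [Fintype X] [DecidableEq X] (F : LCom K X 1) :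
    LCom.proj K X (LCom.d K X 0 F) ∈ ComCom.leibniz K X := by
  have hsupp : ∀ π v, F.1 π v ≠ 0 → IsLevelTree π v := fun π v h =>
    ⟨by by_contra hc; exact h (by simp [F.2.1 π hc]), (F.2.2 π).1 v h⟩
  have key : LCom.proj K X (LCom.d K X 0 F) = ∑ π : Finset (Finset X),
      if h : IsPartialPartition π ∧ 2 ≤ π.card then
        F.1 π ![π] • ComCom.leibnizElt K π h.1 (Finset.card_pos.1 (by omega)) else 0 := by
    ext b
    rw [LCom.proj_apply, Finsupp.finsetSum_apply]
    have hl : IsLevelTree {b.1} (![] : Fin 0 → Finset (Finset X)) := by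
      refine ⟨⟨by simpa using b.2, by simp⟩, Function.injective_of_subsingleton _, by simp,
        by simp, by simp, by simp, by simp⟩
    have h1 : barD K {b.1} 0 (F.1 {b.1}) ![] = 0 := by
      rw [barD, LinearMap.coe_mk, AddHom.coe_mk, neg_eq_zero]
      refine Finset.sum_eq_zero fun A hA => ?_
      by_contra h
      have h2 := (hsupp _ _ h).2.2.two_le A ⟨0, rfl⟩
      have h3 := Finset.card_lt_card (Finset.mem_ssubsets.1 hA)
      rw [Finset.card_singleton] at h3
      omega
    have hF : ∀ π : Finset (Finset X), F.1 π (Fin.cons π ![]) ≠ 0 →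
        IsPartialPartition π ∧ 2 ≤ π.card := fun π h =>
      ⟨(hsupp _ _ h).1, (hsupp _ _ h).2.2.two_le π ⟨0, rfl⟩⟩
    change barD K {b.1} 0 (F.1 {b.1}) ![] - deltaL K 0 F.1 {b.1} ![] +
      deltaR K 0 F.1 {b.1} ![] = _
    rw [h1, zero_sub, deltaL, deltaR]
    simp only [LinearMap.coe_mk, AddHom.coe_mk, if_pos hl, Finset.sum_filter]
    rw [← Finset.sum_neg_distrib, ← Finset.sum_add_distrib]
    refine Finset.sum_congr rfl fun π _ => ?_
    have h4 : (fun i => expand π ((![] : Fin 0 → Finset (Finset X)) i)) = ![] :=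
      Subsingleton.elim _ _
    have hv : (![π] : Fin 1 → Finset (Finset X)) = Fin.cons π ![] := rfl
    rw [h4]
    by_cases hπ : IsPartialPartition π ∧ 2 ≤ π.card
    · rw [dif_pos hπ, Finsupp.smul_apply, ComCom.leibnizElt_apply, hv]
      have h5 : {b.1} ⊂ π ↔ b.1 ∈ π := by
        rw [Finset.ssubset_iff_subset_ne, Finset.singleton_subset_iff, and_iff_left_iff_imp]
        rintro - rfl
        simp at hπ
      by_cases h6 : π.sup id = b.1
      · have h7 : expand π {b.1} = π := by
          rw [expand, h6, if_pos (Finset.mem_singleton_self _)]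
          simp
        rw [h7]
        simp only [h5, h6, hπ.2, Finset.mem_singleton, and_self, if_true, smul_eq_mul]
        split_ifs <;> ring
      · simp only [h5, h6, Finset.mem_singleton, and_false, if_false, smul_eq_mul]
        split_ifs <;> ring
    · have h8 : F.1 π (Fin.cons π ![]) = 0 := by
        by_contra h
        exact hπ (hF π h)
      rw [dif_neg hπ, h8, Finsupp.zero_apply, ite_self, neg_zero, zero_add, ite_eq_right_iff]
      rintro ⟨h9, h10⟩
      have h7 : expand π {b.1} = π := by
        rw [Finset.mem_singleton] at h10
        rw [expand, h10, if_pos (Finset.mem_singleton_self _)]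
        simp
      rw [h7, h8]
  rw [key]
  refine Submodule.sum_mem _ fun π _ => ?_
  split_ifs with h
  · exact Submodule.smul_mem _ _ (Submodule.subset_span ⟨π, _, _, rfl⟩)
  · exact Submodule.zero_mem _

/-- The map `L_Com ∘_Com I → Ω_Com ∘_Com I` induced by `L_Com → Com ∘_(1) Com → Ω_Com`, with `Ω_Com` in
degree `0`. -/
noncomputable def LBar.toOmegaBar (n : ℕ) : (k : ℕ) → LBar K n k →ₗ[K] OmegaBar K n
  | 0 => (LCom.decomposables K n 0).mapQ (OmegaCom.decomposables K n)
      ((ComCom.leibniz K (Fin n)).mkQ ∘ₗ LCom.proj K (Fin n)) <| by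
        refine iSup_le fun m => iSup_le fun f => iSup_le fun hf => iSup_le fun hn => ?_
        rintro _ ⟨F, rfl⟩
        rw [Submodule.mem_comap, LinearMap.comp_apply, LCom.proj_rho]
        exact Submodule.mem_iSup_of_mem m (Submodule.mem_iSup_of_mem f
          (Submodule.mem_iSup_of_mem hf (Submodule.mem_iSup_of_mem hn ⟨_, rfl⟩)))
  | _ + 1 => 0

/-- The module of obstructions `O_Com = ker (L_Com ∘_Com I → Ω_Com ∘_Com I)` in arity `n` and
degree `k`. -/
def ObstructionModule (n k : ℕ) : Type _ := LinearMap.ker (LBar.toOmegaBar K n k)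

noncomputable instance (n k : ℕ) : AddCommGroup (ObstructionModule K n k) :=
  inferInstanceAs (AddCommGroup (LinearMap.ker (LBar.toOmegaBar K n k)))

noncomputable instance (n k : ℕ) : Module K (ObstructionModule K n k) :=
  inferInstanceAs (Module K (LinearMap.ker (LBar.toOmegaBar K n k)))

/-- The differential of the module of obstructions. -/
noncomputable def ObstructionModule.d (n k : ℕ) :
    ObstructionModule K n (k + 1) →ₗ[K] ObstructionModule K n k :=
  (LBar.d K n k).restrict (p := LinearMap.ker (LBar.toOmegaBar K n (k + 1)))
    (q := LinearMap.ker (LBar.toOmegaBar K n k)) <| by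
    rintro x -
    cases k with
    | succ k => rfl
    | zero =>
      obtain ⟨F, rfl⟩ := Submodule.mkQ_surjective _ x
      change (OmegaCom.decomposables K n).mkQ ((ComCom.leibniz K (Fin n)).mkQ
        (LCom.proj K (Fin n) (LCom.d K (Fin n) 0 F))) = 0
      have h : (ComCom.leibniz K (Fin n)).mkQ (LCom.proj K (Fin n) (LCom.d K (Fin n) 0 F)) = 0 := by
        rw [Submodule.mkQ_apply, Submodule.Quotient.mk_eq_zero]
        exact LCom.proj_d K F
      rw [h, map_zero]

/-- The first homology of the module of obstructions in arity `n`: cycles of degree `1`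
modulo boundaries. -/
abbrev ObstructionH1 (n : ℕ) : Type _ :=
  LinearMap.ker (ObstructionModule.d K n 0) ⧸
    (LinearMap.range (ObstructionModule.d K n 1)).submoduleOf
      (LinearMap.ker (ObstructionModule.d K n 0))

/-- The element `μ ⊗ (ν ⊗ id)` of `Com ∘_(1) (B(Com) ∘ Com)` in arity `3` and degree `1`. Here `μ` is the
product of two elements, `ν` is the suspended product of two elements: the middle tree has one vertex,
with inputs the variables `0` and `1`, and the two inputs of the lower corolla `μ` are the root of this
tree and the variable `2`. -/
def muNuId : LCom K (Fin 3) 1 :=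
  ⟨fun π v => if π = {{0}, {1}} ∧ v = ![{{0}, {1}}] then 1 else 0, by
    have hpp : IsPartialPartition ({{0}, {1}} : Finset (Finset (Fin 3))) :=
      ⟨by decide, by decide⟩
    have ht : IsTree ({{0}, {1}} : Finset (Finset (Fin 3)))
        (Set.range ![({{0}, {1}} : Finset (Finset (Fin 3)))]) := by
      simp only [Matrix.range_cons, Matrix.range_empty, Set.union_empty]
      refine ⟨by decide, ?_, ?_, ?_, fun _ => rfl⟩
      · rintro A rfl; exact subset_rfl
      · rintro A rfl; decide
      · rintro A rfl B rfl; exact Or.inl subset_rfl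
    refine ⟨fun π h => ?_, fun π => ⟨fun v h => ?_, fun σ v => ?_⟩⟩
    · funext v
      refine if_neg fun hc => h ?_
      rw [hc.1]
      exact hpp
    · simp only [ne_eq, ite_eq_right_iff, not_forall] at h
      obtain ⟨⟨rfl, rfl⟩, -⟩ := h
      exact ⟨Function.injective_of_subsingleton _, ht⟩
    · rw [Subsingleton.elim σ 1]
      simp⟩

/-- The class of `μ ⊗ (ν ⊗ id)` in the module of obstructions. -/
noncomputable def obstructionCycle : ObstructionModule K 3 1 :=
  ⟨(LCom.decomposables K 3 1).mkQ (muNuId K), rfl⟩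

end Quotients

section AndreQuillen

/-- Non-unital graded commutative differential graded `K`-algebras (`ℤ`-graded, with differential of
degree `-1`), i.e. algebras over the operad `Com` with `Com(0) = 0` in chain complexes. -/
structure CDGA (K : Type u) [Field K] where
  carrier : Type u
  [ring : NonUnitalRing carrier]
  [module : Module K carrier]
  [isScalarTower : IsScalarTower K carrier carrier]
  [smulCommClass : SMulCommClass K carrier carrier]
  gr : ℤ → Submodule K carrier
  isInternal : DirectSum.IsInternal gr
  mul_mem : ∀ {i j : ℤ} {a b : carrier}, a ∈ gr i → b ∈ gr j → a * b ∈ gr (i + j)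
  mul_comm : ∀ {i j : ℤ} {a b : carrier}, a ∈ gr i → b ∈ gr j →
    a * b = ((i * j).negOnePow : ℤ) • (b * a)
  d : carrier →ₗ[K] carrier
  d_mem : ∀ {i : ℤ} {a : carrier}, a ∈ gr i → d a ∈ gr (i - 1)
  d_d : ∀ a, d (d a) = 0
  leibniz : ∀ {i : ℤ} {a : carrier}, a ∈ gr i → ∀ b,
    d (a * b) = d a * b + (i.negOnePow : ℤ) • (a * d b)

attribute [instance] CDGA.ring CDGA.module CDGA.isScalarTower CDGA.smulCommClass

variable {K : Type u} [Field K]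

/-- Morphisms of commutative differential graded algebras. -/
structure CDGA.Hom (R S : CDGA K) where
  toFun : R.carrier →ₙₐ[K] S.carrier
  map_gr : ∀ {i : ℤ} {a : R.carrier}, a ∈ R.gr i → toFun a ∈ S.gr i
  map_d : ∀ a, toFun (R.d a) = S.d (toFun a)

/-- Surjective quasi-isomorphisms, the acyclic fibrations of the model structure on algebras. -/
structure CDGA.Hom.IsAcyclicFibration {R S : CDGA K} (p : R.Hom S) : Prop where
  surjective : Function.Surjective p.toFun
  injective_homology : ∀ a, R.d a = 0 → (∃ b, S.d b = p.toFun a) → ∃ a', R.d a' = a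
  surjective_homology : ∀ b, S.d b = 0 → ∃ a, R.d a = 0 ∧ ∃ c, p.toFun a - b = S.d c

/-- Cofibrant algebras: those with the left lifting property against acyclic fibrations. -/
def CDGA.IsCofibrant (R : CDGA K) : Prop :=
  ∀ (S T : CDGA K) (p : S.Hom T) (g : R.Hom T), p.IsAcyclicFibration →
    ∃ h : R.Hom S, ∀ a, p.toFun (h.toFun a) = g.toFun a

/-- A cofibrant resolution of a commutative algebra `A` (in degree `0`): a cofibrant commutative
differential graded algebra with a quasi-isomorphism to `A`. -/
structure Resolution (K : Type u) [Field K] (A : Type u) [NonUnitalCommRing A] [Module K A] [IsScalarTower K A A]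
    [SMulCommClass K A A] where
  R : CDGA K
  ε : R.carrier →ₙₐ[K] A
  ε_gr : ∀ {i : ℤ}, i ≠ 0 → ∀ {a : R.carrier}, a ∈ R.gr i → ε a = 0
  ε_d : ∀ a, ε (R.d a) = 0
  cofibrant : R.IsCofibrant
  injective_homology : ∀ a, R.d a = 0 → ε a = 0 → ∃ a', R.d a' = a
  surjective_homology : ∀ x, ∃ a, R.d a = 0 ∧ ε a = x

variable {A : Type u} [NonUnitalCommRing A] [Module K A] [IsScalarTower K A A]
    [SMulCommClass K A A]

namespace Resolution
variable (P : Resolution K A)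

/-- The Leibniz relations `δ(rs) = r δ(s) + s δ(r)` (with signs); here `r` and `s` act through
`ε`, on modules over the enveloping algebra `A ⊗^Com K = K ⊕ A` of `A`. -/
def relations : Submodule (Unitization K A) (Unitization K A ⊗[K] P.R.carrier) :=
  Submodule.span _ {t | ∃ (i j : ℤ) (r s : P.R.carrier), r ∈ P.R.gr i ∧ s ∈ P.R.gr j ∧
    t = 1 ⊗ₜ (r * s) - (P.ε r : Unitization K A) ⊗ₜ s
      - ((i * j).negOnePow : ℤ) • ((P.ε s : Unitization K A) ⊗ₜ r)}

/-- `A ⊗_R Ω_{R/K}`, the Kähler differential forms of the resolution, with coefficients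
extended to the enveloping algebra `K ⊕ A` of `A`. As `ℤ`-graded complex this is the cotangent complex
of `A`. -/
abbrev Diff : Type u := (Unitization K A ⊗[K] P.R.carrier) ⧸ P.relations

/-- The universal derivation. -/
def δ (r : P.R.carrier) : P.Diff := Submodule.Quotient.mk (1 ⊗ₜ r)

/-- The homogeneous part of degree `i`. -/
def diffGr (i : ℤ) : Submodule (Unitization K A) P.Diff :=
  Submodule.span _ {t | ∃ r ∈ P.R.gr i, t = P.δ r}

theorem negOnePow_smul_ε {i : ℤ} (c : ℤ) {r : P.R.carrier} (hr : r ∈ P.R.gr i) :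
    ((c * i).negOnePow : ℤ) • (P.ε r : Unitization K A) = (P.ε r : Unitization K A) := by
  by_cases h : i = 0
  · simp [h]
  · simp [P.ε_gr h hr]

theorem baseChange_d_mem : P.relations ≤
    P.relations.comap (P.R.d.baseChange (Unitization K A)) := by
  rw [relations, Submodule.span_le]
  rintro _ ⟨i, j, r, s, hr, hs, rfl⟩
  have h1 : (1 : Unitization K A) ⊗ₜ[K] (P.R.d r * s) -
      (P.ε (P.R.d r) : Unitization K A) ⊗ₜ[K] s -
      (((i - 1) * j).negOnePow : ℤ) • ((P.ε s : Unitization K A) ⊗ₜ[K] P.R.d r) ∈ P.relations :=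
    Submodule.subset_span ⟨i - 1, j, _, _, P.R.d_mem hr, hs, rfl⟩
  have h2 : (1 : Unitization K A) ⊗ₜ[K] (r * P.R.d s) -
      (P.ε r : Unitization K A) ⊗ₜ[K] P.R.d s -
      ((i * (j - 1)).negOnePow : ℤ) • ((P.ε (P.R.d s) : Unitization K A) ⊗ₜ[K] r) ∈
        P.relations :=
    Submodule.subset_span ⟨i, j - 1, _, _, hr, P.R.d_mem hs, rfl⟩
  have h3 := P.relations.add_mem h1 (zsmul_mem h2 (i.negOnePow : ℤ))
  have e1 : (i.negOnePow : ℤ) • ((P.ε r : Unitization K A) ⊗ₜ[K] P.R.d s) =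
      (P.ε r : Unitization K A) ⊗ₜ[K] P.R.d s := by
    have := P.negOnePow_smul_ε 1 hr
    rw [one_mul] at this
    rw [TensorProduct.smul_tmul', this]
  have e2 : ∀ c : ℤ, ((c * j).negOnePow : ℤ) • ((P.ε s : Unitization K A) ⊗ₜ[K] P.R.d r) =
      (P.ε s : Unitization K A) ⊗ₜ[K] P.R.d r := fun c => by
    rw [TensorProduct.smul_tmul', P.negOnePow_smul_ε c hs]
  change P.R.d.baseChange (Unitization K A) _ ∈ P.relations
  rw [map_sub, map_sub, map_zsmul, LinearMap.baseChange_tmul, LinearMap.baseChange_tmul,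
    LinearMap.baseChange_tmul, P.R.leibniz hr, e2, TensorProduct.tmul_add, TensorProduct.tmul_smul]
  rw [e2, P.ε_d, P.ε_d, smul_sub, smul_sub, e1] at h3
  simpa [sub_eq_add_neg, add_assoc, add_comm, add_left_comm] using h3

/-- The differential of the cotangent complex, before splitting it into degrees. -/
noncomputable def diffD : P.Diff →ₗ[Unitization K A] P.Diff :=
  P.relations.mapQ P.relations (P.R.d.baseChange (Unitization K A)) P.baseChange_d_mem

theorem diffD_δ (r : P.R.carrier) : P.diffD (P.δ r) = P.δ (P.R.d r) := rfl

theorem diffD_diffD (x : P.Diff) : P.diffD (P.diffD x) = 0 := by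
  obtain ⟨t, rfl⟩ := Submodule.mkQ_surjective _ x
  change Submodule.Quotient.mk (P.R.d.baseChange _ (P.R.d.baseChange _ t)) = 0
  have : P.R.d.baseChange (Unitization K A) ∘ₗ P.R.d.baseChange (Unitization K A) = 0 := by
    rw [← LinearMap.baseChange_comp]
    have h : P.R.d ∘ₗ P.R.d = 0 := LinearMap.ext P.R.d_d
    rw [h, LinearMap.baseChange_zero]
  rw [← LinearMap.comp_apply, this]
  rfl

theorem diffD_mem {i j : ℤ} (h : i - 1 = j) :
    ∀ x ∈ P.diffGr i, P.diffD x ∈ P.diffGr j := by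
  subst h
  change P.diffGr i ≤ (P.diffGr (i - 1)).comap P.diffD
  rw [diffGr, Submodule.span_le]
  rintro _ ⟨r, hr, rfl⟩
  exact Submodule.subset_span ⟨_, P.R.d_mem hr, P.diffD_δ r⟩

/-- The cotangent complex of `A`, in cohomological indexing: degree `n` is the part of homological
degree `-n`. -/
noncomputable def cotangentComplex : CochainComplex (ModuleCat.{u} (Unitization K A)) ℤ where
  X n := ModuleCat.of _ (P.diffGr (-n))
  d i j := if h : i + 1 = j then ModuleCat.ofHom (P.diffD.restrict (P.diffD_mem (by omega))) else 0
  shape i j h := dif_neg h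
  d_comp_d' i j k hij hjk := by
    rw [dif_pos (show i + 1 = j from hij), dif_pos (show j + 1 = k from hjk)]
    refine ModuleCat.hom_ext (LinearMap.ext fun x => Subtype.ext ?_)
    exact P.diffD_diffD x.1

/-- The module of Kähler differential forms of `A`, a module over the enveloping algebra
`K ⊕ A`. It coincides with the Kähler differential forms of this unital algebra. -/
noncomputable abbrev kaehler (K : Type u) [Field K] (A : Type u) [NonUnitalCommRing A] [Module K A]
    [IsScalarTower K A A] [SMulCommClass K A A] : ModuleCat.{u} (Unitization K A) :=
  ModuleCat.of _ (Ω[Unitization K A⁄K])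

/-- The map `δ r ↦ D (ε r)` to the Kähler differential forms of `A`. -/
noncomputable def diffToKaehler : P.Diff →ₗ[Unitization K A] Ω[Unitization K A⁄K] :=
  P.relations.liftQ (LinearMap.liftBaseChange (Unitization K A)
    ((KaehlerDifferential.D K (Unitization K A)).toLinearMap ∘ₗ
      (Unitization.inrHom K K A) ∘ₗ (P.ε : P.R.carrier →ₗ[K] A))) <| by
    rw [relations, Submodule.span_le]
    rintro _ ⟨i, j, r, s, hr, hs, rfl⟩
    have h := P.negOnePow_smul_ε i hs
    rw [TensorProduct.smul_tmul', h]
    simp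

theorem diffToKaehler_diffD (x : P.Diff) : P.diffToKaehler (P.diffD x) = 0 := by
  have h : P.diffToKaehler ∘ₗ P.diffD = 0 := by
    refine Submodule.linearMap_qext _ (TensorProduct.AlgebraTensorModule.curry_injective
      (LinearMap.ext_ring (LinearMap.ext fun r => ?_)))
    change (1 : Unitization K A) • KaehlerDifferential.D K (Unitization K A)
      (Unitization.inr (P.ε (P.R.d r))) = 0
    rw [P.ε_d, Unitization.inr_zero, map_zero, smul_zero]
  exact LinearMap.congr_fun h x

/-- The canonical morphism from the cotangent complex of `A` to its Kähler differential forms. -/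
noncomputable def cotangentToKaehler : P.cotangentComplex ⟶
    (HomologicalComplex.single _ (ComplexShape.up ℤ) 0).obj (kaehler K A) :=
  HomologicalComplex.mkHomToSingle
    (ModuleCat.ofHom (P.diffToKaehler ∘ₗ (P.diffGr (-0)).subtype)) <| by
    intro i hi
    have h : P.cotangentComplex.d i 0 =
        ModuleCat.ofHom (P.diffD.restrict (P.diffD_mem (by have : i + 1 = 0 := hi; omega))) :=
      dif_pos hi
    rw [h]
    refine ModuleCat.hom_ext (LinearMap.ext fun x => ?_)
    exact P.diffToKaehler_diffD x.1

/-- The comparison map `Extⁿ_{K ⊕ A}(Ω_A, M) → Hⁿ_Com(A, M)`. The André-Quillen cohomology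
`Hⁿ_Com(A, M)` is the group of morphisms from the cotangent complex of `A` to `M[n]` in the derived
category of modules over the enveloping algebra. -/
noncomputable def extToAndreQuillen (M : ModuleCat.{u} (Unitization K A)) (n : ℕ) :
    letI := HasDerivedCategory.standard (ModuleCat.{u} (Unitization K A))
    Abelian.Ext (kaehler K A) M n →
      ShiftedHom (DerivedCategory.Q.obj P.cotangentComplex)
        ((DerivedCategory.singleFunctor _ 0).obj M) (n : ℤ) :=
  letI := HasDerivedCategory.standard (ModuleCat.{u} (Unitization K A))
  fun e => DerivedCategory.Q.map P.cotangentToKaehler ≫ e.hom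

/-- The André-Quillen cohomology of `A` is the Ext-functor over its enveloping algebra
`A ⊗^Com K = K ⊕ A`: all comparison maps are bijective. -/
def AndreQuillenIsExt : Prop :=
  ∀ (M : ModuleCat.{u} (Unitization K A)) (n : ℕ), Function.Bijective (P.extToAndreQuillen M n)

end Resolution

end AndreQuillen

end ComObstruction

/-! The two halves of the theorem are independent computations.

Arity three. A basis element of `LCom` lies in `LCom.decomposables` as soon as some block has two
elements or two variables lie in no block, because these two inputs can be merged first. What
survives has singleton blocks and at most one variable outside them. In arity `3` and degree `1`
this leaves the ternary corolla and the three elements `μ ⊗ (ν ⊗ id)`; in degree `0` nothing is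
left. So `μ ⊗ (ν ⊗ id)` is a cycle: its differential in `LCom` is the Leibniz expression of
`LCom.d_muNuId`, whose three terms are all decomposable. In degree `2` there are the three binary
trees, with root `{0, 1, 2}` and one inner vertex. Up to a common sign, the differential of such a
tree is the difference between the ternary corolla (contraction of the edge) and one of the elements
`μ ⊗ (ν ⊗ id)` (root split off by `deltaL`). Boundaries therefore have coefficient sum zero, and the
functional `corollaSum` detects the cycle: it vanishes on decomposables and on boundaries
(`corollaSum_decomposables`, `corollaSum_d`) and is `1` on `muNuId`.

The algebra. Let `A = K x` with `x² = 0`, so that the enveloping algebra is the ring of dual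
numbers. The free algebra on `x` and `e` with `d e = x²` is a cofibrant resolution of `A`, and its
cotangent complex is free with generators in homological degrees `0` and `1` only; hence it has no
nonzero maps to `M[2]` in the derived category (`derivedHom_single_eq_zero`). On the other side `2 x
dx = d(x²) = 0`, so in characteristic `0` the module of Kähler differentials is the trivial module.
It is its own syzygy in the non-split sequence `0 → Ω → K ⊕ A → Ω → 0`, so `Ext²(Ω, Ω) ≠ 0`
(`exists_kaehler_ext_two_ne_zero`).

An arbitrary cofibrant resolution `P` maps to this one over `A` by the lifting property. Its map to
the Kähler differentials then factors through the short cotangent complex, so the comparison map in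
degree `2` is zero on a nonzero group. Uniqueness of resolutions up to homotopy is not needed. -/

namespace ComObstruction

/-! ### The cycle in arity three and the functional that detects it. -/

section ArityThree

/-- A level tree without vertices is a single non-empty block. -/
theorem isLevelTree_zero_iff {X : Type*} {π : Finset (Finset X)} {v : Fin 0 → Finset (Finset X)} :
    IsLevelTree π v ↔ ∃ b : Finset X, b.Nonempty ∧ π = {b} := by
  constructor
  · rintro ⟨h1, -, h2⟩
    have h3 : π.card = 1 := by
      have h4 := Finset.card_pos.2 h2.nonempty
      by_contra h5
      obtain ⟨i, -⟩ := h2.root (by omega)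
      exact i.elim0
    obtain ⟨b, rfl⟩ := Finset.card_eq_one.1 h3
    exact ⟨b, h1.nonempty b (Finset.mem_singleton_self b), rfl⟩
  · rintro ⟨b, hb, rfl⟩
    exact ⟨⟨by simpa using hb, by simp⟩, Function.injective_of_subsingleton _, by simp,
      by simp, by simp, by simp, by simp⟩

theorem LCom.isLevelTree_of_ne_zero {K : Type*} [Field K] {X : Type*} {k : ℕ} (F : LCom K X k)
    {π : Finset (Finset X)} {v : Fin k → Finset (Finset X)} (h : F.1 π v ≠ 0) :
    IsLevelTree π v :=
  ⟨by by_contra hc; exact h (by simp [F.2.1 π hc]), (F.2.2 π).1 v h⟩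

/-- The basis element of `L_Com(X)` in degree `0` whose only block is `B`. -/
def LCom.block (K : Type*) [Field K] {X : Type*} [DecidableEq X] (B : Finset X)
    (hB : B.Nonempty) : LCom K X 0 :=
  ⟨fun π _ => if π = {B} then 1 else 0, by
    have hl : IsLevelTree {B} (![] : Fin 0 → Finset (Finset X)) :=
      isLevelTree_zero_iff.2 ⟨B, hB, rfl⟩
    refine ⟨fun π h => ?_, fun π => ⟨fun v h => ?_, fun σ v => ?_⟩⟩
    · funext v
      exact if_neg fun hc => h (by rw [hc]; exact hl.1)
    · simp only [ne_eq, ite_eq_right_iff, not_forall] at h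
      obtain ⟨rfl, -⟩ := h
      rw [Subsingleton.elim v ![]]
      exact hl.2
    · rw [Subsingleton.elim σ 1]
      simp⟩

theorem LCom.rho_block {K : Type*} [Field K] {X Z : Type*} [Fintype X] [DecidableEq X] [Fintype Z]
    [DecidableEq Z] {f : X → Z} (hf : Function.Surjective f) (B : Finset Z) (hB : B.Nonempty) :
    LCom.rho K hf 0 (LCom.block K B hB) =
      LCom.block K (preimage f B) ((preimage_nonempty hf B).2 hB) := by
  apply Subtype.ext
  funext π v
  change (∑ ρ : Finset (Finset Z), ∑ w : Fin 0 → Finset (Finset Z),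
    if preimages f ρ = π ∧ (fun i => preimages f (w i)) = v then
      (if ρ = {B} then (1 : K) else 0) else 0) = if π = {preimage f B} then 1 else 0
  rw [Finset.sum_eq_single {B}]
  · rw [Fintype.sum_subsingleton _ ![]]
    simp only [if_true]
    refine if_congr ?_ rfl rfl
    rw [and_iff_left (Subsingleton.elim _ _), preimages, Finset.image_singleton]
    exact eq_comm
  · intro ρ _ h
    simp [h]
  · simp

/-- The criterion for a block to die in `LBar`: it is a union of fibres of a map that merges two
inputs. -/
theorem LCom.block_mem_decomposables {K : Type*} [Field K] {m n : ℕ} {f : Fin n → Fin m}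
    (hf : Function.Surjective f) (hn : ¬ Function.Injective f) (B : Finset (Fin m))
    (hB : B.Nonempty) {C : Finset (Fin n)} (hC : C.Nonempty) (h : preimage f B = C) :
    LCom.block K C hC ∈ LCom.decomposables K n 0 := by
  subst h
  rw [← LCom.rho_block hf B hB]
  exact Submodule.mem_iSup_of_mem m (Submodule.mem_iSup_of_mem f (Submodule.mem_iSup_of_mem hf
    (Submodule.mem_iSup_of_mem hn ⟨_, rfl⟩)))

/-- This is the Leibniz relation for two factors. `deltaR` merges the inputs of `ν` into one block;
`deltaL` composes `ν` with `μ` and leaves either input of `ν` as the marked branch. A tree with one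
vertex has no edge to contract. -/
theorem LCom.d_muNuId (K : Type*) [Field K] :
    LCom.d K (Fin 3) 0 (muNuId K) = LCom.block K {0, 1} (by simp) - LCom.block K {0} (by simp) -
      LCom.block K {1} (by simp) := by
  apply Subtype.ext
  funext π v
  by_cases hl : IsLevelTree π v
  swap
  · rw [show (LCom.d K (Fin 3) 0 (muNuId K)).1 π v = 0 from
      by_contra fun h => hl (LCom.isLevelTree_of_ne_zero _ h)]
    exact (by_contra fun h => hl (LCom.isLevelTree_of_ne_zero _ (Ne.symm h)))
  have hv := Subsingleton.elim v ![]
  subst hv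
  obtain ⟨b, hb, rfl⟩ := isLevelTree_zero_iff.1 hl
  change barD K {b} 0 ((muNuId K).1 {b}) ![] - deltaL K 0 (muNuId K).1 {b} ![] +
    deltaR K 0 (muNuId K).1 {b} ![] = (if ({b} : Finset (Finset (Fin 3))) = {{0, 1}} then 1 else 0)
      - (if ({b} : Finset (Finset (Fin 3))) = {{0}} then 1 else 0)
      - (if ({b} : Finset (Finset (Fin 3))) = {{1}} then 1 else 0)
  have hne : ∀ c : Finset (Fin 3), ({c} : Finset (Finset (Fin 3))) ≠ {{0}, {1}} := by decide
  have h1 : barD K {b} 0 ((muNuId K).1 {b}) ![] = 0 := by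
    simp [barD, muNuId, hne]
  have h2 : deltaL K 0 (muNuId K).1 {b} ![] =
      if ({b} : Finset (Finset (Fin 3))) ⊂ {{0}, {1}} then 1 else 0 := by
    simp only [deltaL, LinearMap.coe_mk, AddHom.coe_mk, if_pos hl, Finset.sum_filter, muNuId]
    rw [Finset.sum_eq_single {{0}, {1}}]
    · refine if_congr Iff.rfl (if_pos ⟨rfl, rfl⟩) rfl
    · intro ρ _ h
      simp [h]
    · simp
  have h3 : deltaR K 0 (muNuId K).1 {b} ![] = if b = {0, 1} then 1 else 0 := by
    simp only [deltaR, LinearMap.coe_mk, AddHom.coe_mk, if_pos hl, Finset.sum_filter, muNuId]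
    rw [Finset.sum_eq_single {{0}, {1}}]
    · by_cases h : b = {0, 1}
      · subst h
        rw [if_pos (by decide), if_pos ⟨by decide, funext fun i => by
          fin_cases i; rfl⟩, if_pos rfl]
      · rw [if_neg h, if_neg]
        rintro ⟨-, h'⟩
        exact h (by simpa [eq_comm] using h')
    · intro D _ h
      have : ¬ ((Fin.cons D fun i => expand D ((![] : Fin 0 → Finset (Finset (Fin 3))) i) :
          Fin 1 → Finset (Finset (Fin 3))) = ![{{0}, {1}}]) := fun h' => h (congrFun h' 0)
      simp [this]
    · simp
  rw [h1, h2, h3]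
  have h4 : ∀ b : Finset (Fin 3), ({b} : Finset (Finset (Fin 3))) ⊂ {{0}, {1}} ↔
      b = {0} ∨ b = {1} := by decide
  simp only [h4, Finset.singleton_inj]
  by_cases h5 : b = {0}
  · subst h5
    simp [show ({0} : Finset (Fin 3)) ≠ {0, 1} by decide,
      show ({0} : Finset (Fin 3)) ≠ {1} by decide]
  · simp only [h5, false_or, if_false]
    ring

theorem obstructionCycle_isCycle (K : Type*) [Field K] :
    ObstructionModule.d K 3 0 (obstructionCycle K) = 0 := by
  apply Subtype.ext
  change (LCom.decomposables K 3 0).mkQ (LCom.d K (Fin 3) 0 (muNuId K)) = 0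
  rw [Submodule.mkQ_apply, Submodule.Quotient.mk_eq_zero, LCom.d_muNuId]
  refine Submodule.sub_mem _ (Submodule.sub_mem _ ?_ ?_) ?_
  -- In each term two variables sit in the same corolla, and the map to `Fin 2` identifies them: `0,
  -- 1` in the upper one, then `1, 2` and `0, 2` in the lower one.
  · exact LCom.block_mem_decomposables (f := ![(0 : Fin 2), 0, 1]) (by decide) (by decide) {0}
      (by simp) _ (by decide)
  · exact LCom.block_mem_decomposables (f := ![(0 : Fin 2), 1, 1]) (by decide) (by decide) {0}
      (by simp) _ (by decide)
  · exact LCom.block_mem_decomposables (f := ![(0 : Fin 2), 1, 0]) (by decide) (by decide) {1}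
      (by simp) _ (by decide)

/-- The partition of `{0, 1, 2}` into singletons. -/
def singletons : Finset (Finset (Fin 3)) := {{0}, {1}, {2}}

theorem mem_singletons (i : Fin 3) : {i} ∈ singletons := by
  fin_cases i <;> decide

theorem exists_eq_singleton : ∀ {b}, b ∈ singletons → ∃ i : Fin 3, b = {i} := by
  decide

/-- The sum of the coefficients at the corollas with three inputs, or with two inputs and one
remaining variable, all of whose inputs are variables. -/
def corollaSum (K : Type*) [Field K] : LCom K (Fin 3) 1 →ₗ[K] K where
  toFun F := F.1 singletons ![singletons] +
    ∑ i : Fin 3, F.1 (singletons.erase {i}) ![singletons.erase {i}]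
  map_add' F G := by
    simp [Finset.sum_add_distrib]
    ring
  map_smul' c F := by
    simp [Finset.mul_sum, mul_add]

/-- All blocks in the image of the action are unions of fibres of `f`, and `{x}` is not one when `y`
lies in the same fibre. -/
theorem LCom.rho_apply_eq_zero {K : Type*} [Field K] {X Z : Type*} [Fintype X] [DecidableEq X]
    [Fintype Z] [DecidableEq Z] {f : X → Z} (hf : Function.Surjective f) {k : ℕ} (F : LCom K Z k)
    {x y : X} (hxy : x ≠ y) (h : f x = f y) {π : Finset (Finset X)} (hx : {x} ∈ π)
    (v : Fin k → Finset (Finset X)) : (LCom.rho K hf k F).1 π v = 0 := by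
  by_contra h0
  obtain ⟨ρ, w, rfl, -, -⟩ := exists_of_rhoRaw_ne_zero (F := F.1) h0
  obtain ⟨b, -, hb⟩ := Finset.mem_image.1 hx
  have h1 : x ∈ preimage f b := hb ▸ Finset.mem_singleton_self x
  have h2 : y ∈ preimage f b := by simpa [preimage, ← h] using h1
  rw [hb, Finset.mem_singleton] at h2
  exact hxy h2.symm

/-- If `f` identifies `x` and `y`, each corolla in the sum still contains `{x}` or `{y}`, since it
omits at most one singleton. So every coefficient vanishes separately. -/
theorem corollaSum_decomposables (K : Type*) [Field K] :
    LCom.decomposables K 3 1 ≤ LinearMap.ker (corollaSum K) := by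
  refine iSup_le fun m => iSup_le fun f => iSup_le fun hf => iSup_le fun hn => ?_
  rintro _ ⟨F, rfl⟩
  simp only [Function.Injective, not_forall] at hn
  obtain ⟨x, y, h, hxy⟩ := hn
  rw [LinearMap.mem_ker]
  change (LCom.rho K hf 1 F).1 _ _ + ∑ i : Fin 3, (LCom.rho K hf 1 F).1 _ _ = 0
  rw [LCom.rho_apply_eq_zero hf F hxy h (mem_singletons x), zero_add]
  refine Finset.sum_eq_zero fun i _ => ?_
  by_cases hi : x = i
  · refine LCom.rho_apply_eq_zero hf F (Ne.symm hxy) h.symm (Finset.mem_erase.2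
      ⟨fun h' => hxy ?_, mem_singletons y⟩) _
    rw [hi, Finset.singleton_injective h']
  · exact LCom.rho_apply_eq_zero hf F hxy h (Finset.mem_erase.2
      ⟨fun h' => hi (Finset.singleton_injective h'), mem_singletons x⟩) _

/-- A block with one element cannot be cut. -/
theorem deltaR_apply_eq_zero {K : Type*} [Field K] {X : Type*} [Fintype X] [DecidableEq X] {k : ℕ}
    (F : LCom K X (k + 1)) {π : Finset (Finset X)} (hπ : ∀ b ∈ π, ∃ x, b = {x})
    (v : Fin k → Finset (Finset X)) : deltaR K k F.1 π v = 0 := by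
  simp only [deltaR, LinearMap.coe_mk, AddHom.coe_mk]
  split_ifs with hl
  swap
  · rfl
  refine Finset.sum_eq_zero fun D hD => ?_
  rw [Finset.mem_filter] at hD
  obtain ⟨-, h2, hD⟩ := hD
  by_contra h
  have hp := (LCom.isLevelTree_of_ne_zero F h).1
  rw [expand_of_mem hD] at hp
  obtain ⟨x, hx⟩ := hπ _ hD
  -- The members of `D` are non-empty subsets of `{x}`, so there is at most one of them, against `2
  -- ≤ D.card`.
  have h3 : D ⊆ {{x}} := fun b hb => Finset.mem_singleton.2 <|
    ((hp.nonempty b (Finset.mem_union_right _ hb)).subset_singleton_iff).1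
      (hx ▸ Finset.le_sup (f := id) hb)
  have h4 := Finset.card_le_card h3
  rw [Finset.card_singleton] at h4
  omega

theorem isLevelTree_corolla {X : Type*} {π : Finset (Finset X)} (h : IsPartialPartition π)
    (h2 : 2 ≤ π.card) : IsLevelTree π ![π] := by
  refine ⟨h, Function.injective_of_subsingleton _, Finset.card_pos.1 (by omega), ?_, ?_, ?_,
    fun _ => ⟨0, rfl⟩⟩
  · rintro _ ⟨i, rfl⟩
    simp
  · rintro _ ⟨i, rfl⟩
    simpa using h2
  · rintro _ ⟨i, rfl⟩ _ ⟨j, rfl⟩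
    simp

/-- A further block is disjoint from the two given singletons, hence equals `{i}`. Thus `deltaL`
receives only one contribution at a binary corolla, and none at the ternary one. -/
theorem eq_singletons_of_ssubset {ρ : Finset (Finset (Fin 3))} (hρ : IsPartialPartition ρ)
    {i : Fin 3} (h : singletons.erase {i} ⊂ ρ) : ρ = singletons := by
  have key : ∀ b ∈ ρ, b ∈ singletons := fun b hb => by
    by_cases hm : b ∈ singletons.erase {i}
    · exact Finset.mem_of_mem_erase hm
    have h1 : ∀ x ∈ b, x = i := fun x hx => by
      by_contra hi
      have hx' : {x} ∈ singletons.erase {i} :=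
        Finset.mem_erase.2 ⟨fun h' => hi (Finset.singleton_injective h'), mem_singletons x⟩
      refine Finset.disjoint_left.1 (hρ.disjoint b hb {x} (h.subset hx') fun h' => hm (h' ▸ hx'))
        hx (Finset.mem_singleton_self x)
    rw [(hρ.nonempty b hb).subset_singleton_iff.1 fun x hx => Finset.mem_singleton.2 (h1 x hx)]
    exact mem_singletons i
  refine Finset.Subset.antisymm key fun b hb => ?_
  by_cases hm : b ∈ singletons.erase {i}
  · exact h.subset hm
  obtain ⟨c, hc, hc'⟩ := Finset.exists_of_ssubset h
  have e : ∀ a, a ∈ singletons → a ∉ singletons.erase {i} → a = {i} := fun a h1 h2 => by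
    by_contra h3
    exact h2 (Finset.mem_erase.2 ⟨h3, h1⟩)
  rw [e b hb hm, ← e c (key c hc) hc']
  exact hc

/-- A tree with root `{0, 1, 2}` and inner vertex omitting `i` contributes once to the ternary
corolla, by edge contraction, and once to the binary corolla omitting `i`, by splitting off the
root. The two contributions have opposite signs. `deltaR` plays no role, as it would have to cut a
singleton. -/
theorem corollaSum_d (K : Type*) [Field K] (G : LCom K (Fin 3) 2) :
    corollaSum K (LCom.d K (Fin 3) 1 G) = 0 := by
  have hT : IsPartialPartition singletons := ⟨by decide, by decide⟩
  have hE : ∀ i : Fin 3, IsPartialPartition (singletons.erase {i}) := fun i =>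
    ⟨fun b hb => hT.nonempty b (Finset.mem_of_mem_erase hb), fun b hb c hc =>
      hT.disjoint b (Finset.mem_of_mem_erase hb) c (Finset.mem_of_mem_erase hc)⟩
  have hc : ∀ i : Fin 3, (singletons.erase {i}).card = 2 := by decide
  have hs : ∀ i : Fin 3, ∀ b ∈ singletons.erase {i}, ∃ x, b = {x} := fun i b hb =>
    exists_eq_singleton (Finset.mem_of_mem_erase hb)
  -- Contraction puts the inner vertex first and `deltaL` puts the root first; the sign of this
  -- reordering makes the sum cancel.
  have hswap : ∀ A B : Finset (Finset (Fin 3)),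
      G.1 singletons (Fin.cons A ![B]) = - G.1 singletons (Fin.cons B ![A]) := fun A B => by
    have := (G.2.2 singletons).2 (Equiv.swap 0 1) (Fin.cons B ![A])
    rw [Equiv.Perm.sign_swap (by decide)] at this
    have e : (Fin.cons B ![A] : Fin 2 → Finset (Finset (Fin 3))) ∘ Equiv.swap (0 : Fin 2) 1 =
        Fin.cons A ![B] := by
      funext i
      fin_cases i <;> rfl
    rw [e] at this
    simpa using this
  have h1 : (LCom.d K (Fin 3) 1 G).1 singletons ![singletons] =
      -∑ i : Fin 3, G.1 singletons (Fin.cons (singletons.erase {i}) ![singletons]) := by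
    change barD K _ 1 (G.1 _) _ - deltaL K 1 G.1 _ _ + deltaR K 1 G.1 _ _ = _
    rw [deltaR_apply_eq_zero G fun b hb => exists_eq_singleton hb, add_zero]
    have h : deltaL K 1 G.1 singletons ![singletons] = 0 := by
      simp only [deltaL, LinearMap.coe_mk, AddHom.coe_mk]
      split_ifs
      swap
      · rfl
      refine Finset.sum_eq_zero fun ρ hρ => ?_
      rw [Finset.mem_filter] at hρ
      by_contra h
      exact hρ.2.ne (eq_singletons_of_ssubset (i := 0) (LCom.isLevelTree_of_ne_zero G h).1
        ((Finset.erase_subset _ _).trans_ssubset hρ.2)).symm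
    rw [h, sub_zero]
    simp only [barD, LinearMap.coe_mk, AddHom.coe_mk, neg_inj]
    symm
    -- A vertex other than the root has at least two of the three leaves, hence omits exactly one.
    refine Finset.sum_of_injOn (fun i => singletons.erase {i}) ?_ ?_ ?_ fun i _ => rfl
    · have : Function.Injective fun i : Fin 3 => singletons.erase {i} := by decide
      exact this.injOn
    · intro i _
      exact Finset.mem_coe.2 (Finset.mem_ssubsets.2 (Finset.erase_ssubset (mem_singletons i)))
    · intro A hA hn
      by_contra h
      have h2 := (LCom.isLevelTree_of_ne_zero G h).2.2.two_le A ⟨0, rfl⟩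
      rw [Finset.mem_ssubsets] at hA
      obtain ⟨c, hcT, hcA⟩ := Finset.exists_of_ssubset hA
      obtain ⟨i, rfl⟩ := exists_eq_singleton hcT
      refine hn ⟨i, by simp, (Finset.eq_of_subset_of_card_le (fun b hb => ?_) ?_).symm⟩
      · exact Finset.mem_erase.2 ⟨fun h' => hcA (h' ▸ hb), hA.subset hb⟩
      · rw [hc]
        exact h2
  have h2 : ∀ i : Fin 3, (LCom.d K (Fin 3) 1 G).1 (singletons.erase {i}) ![singletons.erase {i}] =
      G.1 singletons (Fin.cons (singletons.erase {i}) ![singletons]) := fun i => by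
    change barD K _ 1 (G.1 _) _ - deltaL K 1 G.1 _ _ + deltaR K 1 G.1 _ _ = _
    have h : barD K (singletons.erase {i}) 1 (G.1 (singletons.erase {i}))
        ![singletons.erase {i}] = 0 := by
      simp only [barD, LinearMap.coe_mk, AddHom.coe_mk, neg_eq_zero]
      refine Finset.sum_eq_zero fun A hA => ?_
      by_contra h
      have h2 := (LCom.isLevelTree_of_ne_zero G h).2.2.two_le A ⟨0, rfl⟩
      have h3 := Finset.card_lt_card (Finset.mem_ssubsets.1 hA)
      rw [hc] at h3
      omega
    rw [deltaR_apply_eq_zero G (hs i), add_zero, h, zero_sub, hswap, neg_eq_iff_eq_neg, neg_neg]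
    simp only [deltaL, LinearMap.coe_mk, AddHom.coe_mk,
      if_pos (isLevelTree_corolla (hE i) (hc i).ge)]
    rw [Finset.sum_eq_single singletons]
    · intro ρ hρ hn
      rw [Finset.mem_filter] at hρ
      by_contra h
      exact hn (eq_singletons_of_ssubset (LCom.isLevelTree_of_ne_zero G h).1 hρ.2)
    · intro h
      exact absurd (Finset.mem_filter.2 ⟨Finset.mem_univ _,
        Finset.erase_ssubset (mem_singletons i)⟩) h
  change (LCom.d K (Fin 3) 1 G).1 singletons ![singletons] +
    ∑ i : Fin 3, (LCom.d K (Fin 3) 1 G).1 (singletons.erase {i}) ![singletons.erase {i}] = 0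
  rw [h1, Finset.sum_congr rfl fun i _ => h2 i, neg_add_cancel]

theorem corollaSum_muNuId (K : Type*) [Field K] : corollaSum K (muNuId K) = 1 := by
  have h1 : (singletons.erase {0} : Finset (Finset (Fin 3))) ≠ {{0}, {1}} := by decide
  have h2 : (singletons.erase {1} : Finset (Finset (Fin 3))) ≠ {{0}, {1}} := by decide
  have h3 : (singletons.erase {2} : Finset (Finset (Fin 3))) = {{0}, {1}} := by decide
  have h4 : singletons ≠ {{0}, {1}} := by decide
  simp [corollaSum, muNuId, Fin.sum_univ_three, h1, h2, h3, h4]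

theorem obstructionCycle_notMem_range (K : Type*) [Field K] :
    obstructionCycle K ∉ LinearMap.range (ObstructionModule.d K 3 1) := by
  rintro ⟨⟨x, hx⟩, h⟩
  obtain ⟨G, rfl⟩ := Submodule.mkQ_surjective _ x
  have h' : (LCom.decomposables K 3 1).mkQ (LCom.d K (Fin 3) 1 G) =
      (LCom.decomposables K 3 1).mkQ (muNuId K) := congrArg Subtype.val h
  rw [Submodule.mkQ_apply, Submodule.mkQ_apply, Submodule.Quotient.eq] at h'
  have h2 := corollaSum_decomposables K h'
  rw [LinearMap.mem_ker, map_sub, corollaSum_d, corollaSum_muNuId] at h2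
  simp at h2

theorem nontrivial_obstructionH1 (K : Type*) [Field K] : Nontrivial (ObstructionH1 K 3) := by
  refine ⟨Submodule.Quotient.mk ⟨obstructionCycle K, obstructionCycle_isCycle K⟩, 0, fun h => ?_⟩
  rw [Submodule.Quotient.mk_eq_zero] at h
  exact obstructionCycle_notMem_range K h

end ArityThree

/-! ### Gradings concentrated in degrees zero and one. -/

section TwoStepGrading

variable {R M : Type*} [Ring R] [AddCommGroup M] [Module R M]

/-- The grading with `U` in degree `0`, `V` in degree `1` and zero elsewhere. -/
def twoStepGrading (U V : Submodule R M) (i : ℤ) : Submodule R M :=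
  if i = 0 then U else if i = 1 then V else ⊥

theorem mem_twoStepGrading {U V : Submodule R M} {i : ℤ} {a : M} (h : a ∈ twoStepGrading U V i) :
    (i = 0 ∧ a ∈ U) ∨ (i = 1 ∧ a ∈ V) ∨ a = 0 := by
  unfold twoStepGrading at h
  split_ifs at h with h0 h1
  · exact .inl ⟨h0, h⟩
  · exact .inr (.inl ⟨h1, h⟩)
  · exact .inr (.inr h)

theorem isInternal_twoStepGrading {U V : Submodule R M} (h : IsCompl U V) :
    DirectSum.IsInternal (twoStepGrading U V) := by
  rw [DirectSum.isInternal_submodule_iff_iSupIndep_and_iSup_eq_top]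
  constructor
  · intro i
    by_cases h0 : i = 0
    · subst h0
      refine h.disjoint.mono le_rfl (iSup₂_le fun j hj => ?_)
      simp only [twoStepGrading, if_neg hj]
      split_ifs
      exacts [le_rfl, bot_le]
    · by_cases h1 : i = 1
      · subst h1
        refine h.disjoint.symm.mono le_rfl (iSup₂_le fun j hj => ?_)
        simp only [twoStepGrading, if_neg hj]
        split_ifs
        exacts [le_rfl, bot_le]
      · simp [twoStepGrading, h0, h1]
  · rw [eq_top_iff, ← h.sup_eq_top]
    exact sup_le (le_iSup (twoStepGrading U V) 0) (le_iSup (twoStepGrading U V) 1)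

end TwoStepGrading

/-! ### Homogeneous components. -/

section Component

variable {R : Type*} [Ring R]

/-- The projection to the component of degree `i`. -/
noncomputable def component {M : Type*} [AddCommGroup M] [Module R M] {gr : ℤ → Submodule R M}
    (h : DirectSum.IsInternal gr) (i : ℤ) : M →ₗ[R] M :=
  (gr i).subtype ∘ₗ DirectSum.component R ℤ (fun i => gr i) i ∘ₗ
    (LinearEquiv.ofBijective (DirectSum.coeLinearMap gr) h).symm.toLinearMap

variable {M N : Type*} [AddCommGroup M] [Module R M] {gr : ℤ → Submodule R M}
  (h : DirectSum.IsInternal gr) [AddCommGroup N] [Module R N] {gr' : ℤ → Submodule R N}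
  (h' : DirectSum.IsInternal gr')

theorem component_mem (i : ℤ) (a : M) : component h i a ∈ gr i := Subtype.prop _

theorem component_of_mem {i j : ℤ} {a : M} (ha : a ∈ gr i) :
    component h j a = if i = j then a else 0 := by
  have e : (LinearEquiv.ofBijective (DirectSum.coeLinearMap gr) h).symm a =
      DirectSum.lof R ℤ (fun i => gr i) i ⟨a, ha⟩ := by
    rw [LinearEquiv.symm_apply_eq]
    exact (DirectSum.coeLinearMap_lof gr i ⟨a, ha⟩).symm
  simp only [component, LinearMap.comp_apply, LinearEquiv.coe_coe, e]
  by_cases hij : i = j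
  · subst hij
    simp [DirectSum.component.lof_self]
  · rw [DirectSum.component.of, dif_neg hij, if_neg hij]
    rfl

/-- Linearity reduces this to homogeneous elements. It serves to make solutions of linear equations
homogeneous. -/
theorem map_component (φ : M →ₗ[R] N) (k : ℤ) (hφ : ∀ i, ∀ a ∈ gr i, φ a ∈ gr' (i + k)) (i : ℤ)
    (a : M) : component h' (i + k) (φ a) = φ (component h i a) := by
  have hs := h.submodule_iSup_eq_top
  have ha : a ∈ ⨆ i, gr i := hs ▸ Submodule.mem_top
  induction ha using Submodule.iSup_induction' with
  | mem j x hx =>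
    rw [component_of_mem h hx, component_of_mem h' (hφ j x hx)]
    simp only [add_left_inj]
    split_ifs <;> simp
  | zero => simp
  | add x y _ _ hx hy => simp [hx, hy]

end Component

/-! ### Lifting one generator against an acyclic fibration. -/

section Lifting

variable {K : Type u} [Field K]

/-- The extension step for attaching one cell. Injectivity on homology gives `a` with `d a = z`. The
error `y - p a` is a cycle, so it is the image of a cycle `c` up to a boundary, and that boundary
lifts because `p` is surjective. -/
theorem CDGA.Hom.IsAcyclicFibration.exists_lift {S T : CDGA K} {p : S.Hom T}
    (hp : p.IsAcyclicFibration) {i : ℤ} {z : S.carrier} (hz : z ∈ S.gr (i - 1)) (hdz : S.d z = 0)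
    {y : T.carrier} (hy : y ∈ T.gr i) (hdy : T.d y = p.toFun z) :
    ∃ t ∈ S.gr i, S.d t = z ∧ p.toFun t = y := by
  obtain ⟨a, rfl⟩ := hp.injective_homology z hdz ⟨y, hdy⟩
  obtain ⟨c, hc, w, hw⟩ := hp.surjective_homology (y - p.toFun a) (by
    rw [map_sub, hdy, p.map_d, sub_self])
  obtain ⟨w, rfl⟩ := hp.surjective w
  have h1 : S.d (a + c - S.d w) = S.d a := by
    rw [map_sub, map_add, hc, S.d_d, add_zero, sub_zero]
  have h2 : p.toFun (a + c - S.d w) = y := by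
    rw [map_sub, map_add, p.map_d, ← hw]
    abel
  refine ⟨component S.isInternal i (a + c - S.d w), component_mem _ _ _, ?_, ?_⟩
  · rw [← map_component S.isInternal S.isInternal S.d (-1) fun i a ha => S.d_mem ha, h1,
      component_of_mem _ hz, if_pos (by ring)]
  · have := map_component S.isInternal T.isInternal (p.toFun : S.carrier →ₗ[K] T.carrier) 0
      (fun i a ha => by rw [add_zero]; exact p.map_gr ha) i (a + c - S.d w)
    rw [add_zero] at this
    refine this.symm.trans ?_
    change component T.isInternal i (p.toFun _) = y
    rw [h2, component_of_mem _ hy, if_pos rfl]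

end Lifting

/-! ### Polynomials in an element acting on a non-unital algebra. -/

section PolynomialAction

open Polynomial

variable {K S T : Type*} [Field K] [NonUnitalRing S] [Module K S] [IsScalarTower K S S]
  [SMulCommClass K S S] [NonUnitalRing T] [Module K T] [IsScalarTower K T T]
  [SMulCommClass K T T]

/-- The product of `p(s)` and `x`, in a non-unital algebra. -/
noncomputable def polyMul (s : S) (p : K[X]) : S →ₗ[K] S := aeval (LinearMap.mulLeft K s) p

theorem polyMul_X_mul (s : S) (p : K[X]) (x : S) : polyMul s (X * p) x = polyMul s p (s * x) := by
  rw [mul_comm, polyMul, aeval_mul, aeval_X]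
  rfl

theorem polyMul_mul (s : S) (p q : K[X]) (x : S) :
    polyMul s (p * q) x = polyMul s p (polyMul s q x) := by
  simp [polyMul]

theorem polyMul_add (s : S) (p q : K[X]) (x : S) :
    polyMul s (p + q) x = polyMul s p x + polyMul s q x := by
  simp [polyMul]

theorem polyMul_C (s : S) (c : K) (x : S) : polyMul s (C c) x = c • x := by
  simp [polyMul]

/-- A linear map that intertwines the multiplications by `s` and `t` intertwines the multiplications
by `p(s)` and `p(t)`. -/
theorem polyMul_induction (s : S) {φ : S →ₗ[K] T} {t : T} (h : ∀ x, φ (s * x) = t * φ x)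
    (p : K[X]) (x : S) : φ (polyMul s p x) = polyMul t p (φ x) := by
  induction p using Polynomial.induction_on generalizing x with
  | C a => simp [polyMul_C]
  | add p q hp hq => simp [polyMul_add, hp, hq]
  | monomial n a ih =>
    rw [show C a * X ^ (n + 1) = X * (C a * X ^ n) by ring, polyMul_X_mul, polyMul_X_mul, ih, h]

theorem polyMul_mul_right (s : S) (p : K[X]) (x y : S) :
    polyMul s p x * y = polyMul s p (x * y) :=
  polyMul_induction s (φ := LinearMap.mulRight K y) (fun x => mul_assoc s x y) p x

theorem mul_polyMul {s x : S} (h : Commute x s) (p : K[X]) (y : S) :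
    x * polyMul s p y = polyMul s p (x * y) :=
  polyMul_induction s (φ := LinearMap.mulLeft K x) (fun y => by
    simp [← mul_assoc, h.eq]) p y

theorem polyMul_mem {s : S} {U : Submodule K S} (h : ∀ x ∈ U, s * x ∈ U) (p : K[X]) {x : S}
    (hx : x ∈ U) : polyMul s p x ∈ U := by
  induction p using Polynomial.induction_on generalizing x with
  | C a => rw [polyMul_C]; exact U.smul_mem a hx
  | add p q hp hq => rw [polyMul_add]; exact U.add_mem (hp hx) (hq hx)
  | monomial n a ih =>
    rw [show C a * X ^ (n + 1) = X * (C a * X ^ n) by ring, polyMul_X_mul]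
    exact ih (h x hx)

end PolynomialAction

/-! ### The algebra with zero multiplication. -/

section NullAlgebra

/-- The one-dimensional algebra with zero multiplication. -/
def NullAlgebra (K : Type u) : Type u := K

namespace NullAlgebra

variable (K : Type u) [Field K]

instance : AddCommGroup (NullAlgebra K) := inferInstanceAs (AddCommGroup K)

instance : Module K (NullAlgebra K) := inferInstanceAs (Module K K)

instance : NonUnitalCommRing (NullAlgebra K) where
  mul _ _ := 0
  left_distrib _ _ _ := (add_zero (0 : NullAlgebra K)).symm
  right_distrib _ _ _ := (add_zero (0 : NullAlgebra K)).symm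
  zero_mul _ := rfl
  mul_zero _ := rfl
  mul_assoc _ _ _ := rfl
  mul_comm _ _ := rfl

variable {K}

@[simp] theorem mul_eq_zero (a b : NullAlgebra K) : a * b = 0 := rfl

instance : IsScalarTower K (NullAlgebra K) (NullAlgebra K) := ⟨fun c _ _ => (smul_zero c).symm⟩

instance : SMulCommClass K (NullAlgebra K) (NullAlgebra K) := ⟨fun c _ _ => smul_zero c⟩

variable (K) in
/-- The generator. -/
def gen : NullAlgebra K := (1 : K)

theorem eq_smul_gen (a : NullAlgebra K) : a = (show K from a) • gen K := (mul_one (show K from a)).symm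

end NullAlgebra

end NullAlgebra

/-! ### Algebras concentrated in degree zero, as targets of augmentations. -/

section AlgebraInDegreeZero

/-- A commutative algebra, as a differential graded algebra in degree `0`. -/
def CDGA.ofAlgebra (K : Type u) [Field K] (A : Type u) [NonUnitalCommRing A] [Module K A]
    [IsScalarTower K A A] [SMulCommClass K A A] : CDGA K where
  carrier := A
  gr := twoStepGrading ⊤ ⊥
  isInternal := isInternal_twoStepGrading isCompl_top_bot
  mul_mem {i j a b} ha hb := by
    obtain ⟨rfl, -⟩ | ⟨-, h⟩ | rfl := mem_twoStepGrading ha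
    · obtain ⟨rfl, -⟩ | ⟨-, h⟩ | rfl := mem_twoStepGrading hb
      · exact Submodule.mem_top
      · rw [(Submodule.mem_bot K).1 h, mul_zero]; exact Submodule.zero_mem _
      · rw [mul_zero]; exact Submodule.zero_mem _
    · rw [(Submodule.mem_bot K).1 h, zero_mul]; exact Submodule.zero_mem _
    · rw [zero_mul]; exact Submodule.zero_mem _
  mul_comm {i j a b} ha hb := by
    obtain ⟨rfl, -⟩ | ⟨-, h⟩ | rfl := mem_twoStepGrading ha
    · simp [_root_.mul_comm a b]
    · simp [(Submodule.mem_bot K).1 h]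
    · simp
  d := 0
  d_mem _ := Submodule.zero_mem _
  d_d _ := rfl
  leibniz _ _ := by simp

end AlgebraInDegreeZero

/-! ### The Koszul resolution: its construction, cofibrancy and homology. -/

section KoszulAlgebra

open Polynomial

/-- The free graded commutative non-unital algebra on `x` of degree `0` and `e` of degree `1`. The pair
`(p, q)` is the element `x p(x) + q(x) e`. -/
def KoszulAlgebra (K : Type u) [Field K] : Type u := K[X] × K[X]

namespace KoszulAlgebra

variable (K : Type u) [Field K]

noncomputable instance : AddCommGroup (KoszulAlgebra K) := inferInstanceAs (AddCommGroup (K[X] × K[X]))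

noncomputable instance : Module K (KoszulAlgebra K) := inferInstanceAs (Module K (K[X] × K[X]))

variable {K}

/-- The element `x p(x) + q(x) e`. -/
def mk (p q : K[X]) : KoszulAlgebra K := (p, q)

theorem mk_surjective (a : KoszulAlgebra K) : ∃ p q, a = mk p q := ⟨a.1, a.2, rfl⟩

theorem mk_inj {p q p' q' : K[X]} : mk p q = mk p' q' ↔ p = p' ∧ q = q' := Prod.mk_inj

theorem mk_add (p q p' q' : K[X]) : mk p q + mk p' q' = mk (p + p') (q + q') := rfl

theorem smul_mk (c : K) (p q : K[X]) : c • mk p q = mk (c • p) (c • q) := rfl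

theorem mk_zero : mk 0 0 = (0 : KoszulAlgebra K) := rfl

theorem mk_neg (p q : K[X]) : -mk p q = mk (-p) (-q) := rfl

/-- Expand `(x p + q e)(x p' + q' e)` with `e² = 0`. The first coordinate omits one factor `x` of
the even part, so one of the two factors `x` in `x² p p'` remains there. -/
noncomputable instance : Mul (KoszulAlgebra K) :=
  ⟨fun a b => mk (X * a.1 * b.1) (X * (a.1 * b.2 + a.2 * b.1))⟩

theorem mk_mul (p q p' q' : K[X]) :
    mk p q * mk p' q' = mk (X * p * p') (X * (p * q' + q * p')) := rfl

noncomputable instance : NonUnitalRing (KoszulAlgebra K) where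
  left_distrib a b c := by
    obtain ⟨p, q, rfl⟩ := mk_surjective a
    obtain ⟨p', q', rfl⟩ := mk_surjective b
    obtain ⟨p'', q'', rfl⟩ := mk_surjective c
    simp only [mk_mul, mk_add, mk_inj]
    constructor <;> ring
  right_distrib a b c := by
    obtain ⟨p, q, rfl⟩ := mk_surjective a
    obtain ⟨p', q', rfl⟩ := mk_surjective b
    obtain ⟨p'', q'', rfl⟩ := mk_surjective c
    simp only [mk_mul, mk_add, mk_inj]
    constructor <;> ring
  zero_mul a := by
    obtain ⟨p, q, rfl⟩ := mk_surjective a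
    simp [← mk_zero, mk_mul]
  mul_zero a := by
    obtain ⟨p, q, rfl⟩ := mk_surjective a
    simp [← mk_zero, mk_mul]
  mul_assoc a b c := by
    obtain ⟨p, q, rfl⟩ := mk_surjective a
    obtain ⟨p', q', rfl⟩ := mk_surjective b
    obtain ⟨p'', q'', rfl⟩ := mk_surjective c
    simp only [mk_mul, mk_inj]
    constructor <;> ring

instance : IsScalarTower K (KoszulAlgebra K) (KoszulAlgebra K) := ⟨fun c a b => by
  obtain ⟨p, q, rfl⟩ := mk_surjective a
  obtain ⟨p', q', rfl⟩ := mk_surjective b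
  simp only [smul_eq_mul, mk_mul, smul_mk, smul_eq_C_mul, mk_inj]
  constructor <;> ring⟩

instance : SMulCommClass K (KoszulAlgebra K) (KoszulAlgebra K) := ⟨fun c a b => by
  obtain ⟨p, q, rfl⟩ := mk_surjective a
  obtain ⟨p', q', rfl⟩ := mk_surjective b
  simp only [smul_eq_mul, mk_mul, smul_mk, smul_eq_C_mul, mk_inj]
  constructor <;> ring⟩

variable (K) in
/-- The polynomials in `x`. -/
noncomputable def even : Submodule K (KoszulAlgebra K) := LinearMap.range (LinearMap.inl K K[X] K[X])

variable (K) in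
/-- The multiples of `e`. -/
noncomputable def odd : Submodule K (KoszulAlgebra K) := LinearMap.range (LinearMap.inr K K[X] K[X])

theorem mk_mem_even (p : K[X]) : mk p 0 ∈ even K := ⟨p, rfl⟩

theorem mk_mem_odd (q : K[X]) : mk 0 q ∈ odd K := ⟨q, rfl⟩

theorem isCompl_even_odd : IsCompl (even K) (odd K) := LinearMap.isCompl_range_inl_inr

variable (K) in
/-- The grading of the Koszul algebra. -/
noncomputable def gr : ℤ → Submodule K (KoszulAlgebra K) := twoStepGrading (even K) (odd K)

theorem mk_mem_gr_zero (p : K[X]) : mk p 0 ∈ gr K 0 := mk_mem_even p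

theorem mk_mem_gr_one (q : K[X]) : mk 0 q ∈ gr K 1 := mk_mem_odd q

theorem gr_cases {i : ℤ} {a : KoszulAlgebra K} (h : a ∈ gr K i) :
    (i = 0 ∧ ∃ p, a = mk p 0) ∨ (i = 1 ∧ ∃ q, a = mk 0 q) ∨ a = 0 := by
  obtain ⟨rfl, p, rfl⟩ | ⟨rfl, q, rfl⟩ | rfl := mem_twoStepGrading h
  exacts [.inl ⟨rfl, p, rfl⟩, .inr (.inl ⟨rfl, q, rfl⟩), .inr (.inr rfl)]

variable (K) in
/-- The differential, with `d x = 0` and `d e = x ^ 2`. -/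
noncomputable def d : KoszulAlgebra K →ₗ[K] KoszulAlgebra K :=
  LinearMap.inl K K[X] K[X] ∘ₗ LinearMap.mulLeft K X ∘ₗ LinearMap.snd K K[X] K[X]

/-- The image of `q e` is `q x² = x · (x q)`, and the first coordinate omits one factor `x`. -/
theorem d_mk (p q : K[X]) : d K (mk p q) = mk (X * q) 0 := rfl

variable (K) in
/-- The Koszul algebra as a commutative differential graded algebra. -/
noncomputable def cdga : CDGA K where
  carrier := KoszulAlgebra K
  gr := gr K
  isInternal := isInternal_twoStepGrading isCompl_even_odd
  mul_mem {i j a b} ha hb := by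
    obtain ⟨rfl, p, rfl⟩ | ⟨rfl, p, rfl⟩ | rfl := gr_cases ha
    · obtain ⟨rfl, q, rfl⟩ | ⟨rfl, q, rfl⟩ | rfl := gr_cases hb
      · simpa [mk_mul] using mk_mem_gr_zero _
      · simpa [mk_mul] using mk_mem_gr_one _
      · rw [mul_zero]; exact Submodule.zero_mem _
    · obtain ⟨rfl, q, rfl⟩ | ⟨rfl, q, rfl⟩ | rfl := gr_cases hb
      · simpa [mk_mul] using mk_mem_gr_one _
      · simp [mk_mul, mk_zero]
      · rw [mul_zero]; exact Submodule.zero_mem _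
    · rw [zero_mul]; exact Submodule.zero_mem _
  mul_comm {i j a b} ha hb := by
    obtain ⟨rfl, p, rfl⟩ | ⟨rfl, p, rfl⟩ | rfl := gr_cases ha
    · obtain ⟨rfl, q, rfl⟩ | ⟨rfl, q, rfl⟩ | rfl := gr_cases hb
      · simp only [mk_mul, zero_mul, Int.negOnePow_zero, Units.val_one, one_smul, mk_inj]
        constructor <;> ring
      · simp only [mk_mul, zero_mul, Int.negOnePow_zero, Units.val_one, one_smul, mk_inj]
        constructor <;> ring
      · simp
    · obtain ⟨rfl, q, rfl⟩ | ⟨rfl, q, rfl⟩ | rfl := gr_cases hb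
      · simp only [mk_mul, mul_zero, Int.negOnePow_zero, Units.val_one, one_smul, mk_inj]
        constructor <;> ring
      · simp [mk_mul, mk_zero]
      · simp
    · simp
  d := d K
  d_mem {i a} ha := by
    obtain ⟨rfl, p, rfl⟩ | ⟨rfl, p, rfl⟩ | rfl := gr_cases ha
    · rw [d_mk, mul_zero, mk_zero]; exact Submodule.zero_mem _
    · exact mk_mem_gr_zero _
    · rw [map_zero]; exact Submodule.zero_mem _
  d_d a := by
    obtain ⟨p, q, rfl⟩ := mk_surjective a
    rw [d_mk, d_mk, mul_zero, mk_zero]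
  leibniz {i a} ha b := by
    obtain ⟨p', q', rfl⟩ := mk_surjective b
    obtain ⟨rfl, p, rfl⟩ | ⟨rfl, p, rfl⟩ | rfl := gr_cases ha
    · simp only [mk_mul, d_mk, mk_add, Int.negOnePow_zero, Units.val_one, one_smul, mk_inj]
      constructor <;> ring
    · simp only [mk_mul, d_mk, mk_add, Int.negOnePow_one, Units.val_neg, Units.val_one, neg_smul,
        one_smul, mk_inj, mk_neg]
      constructor <;> ring
    · simp

theorem polyMul_mk (p a b : K[X]) : polyMul (mk 1 0) p (mk a b) = mk (p * a) (p * b) := by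
  induction p using Polynomial.induction_on generalizing a b with
  | C c => rw [polyMul_C, smul_mk, smul_eq_C_mul, smul_eq_C_mul]
  | add p q hp hq => rw [polyMul_add, hp, hq, mk_add, add_mul, add_mul]
  | monomial n c ih =>
    rw [show C c * X ^ (n + 1) = X * (C c * X ^ n) by ring, polyMul_X_mul, mk_mul, ih, mk_inj]
    constructor <;> ring

/-- The elements `x` and `e` generate under multiplication by polynomials in `x`, so a morphism is
determined by its values on them. -/
theorem mk_eq_polyMul (p q : K[X]) :
    mk p q = polyMul (mk 1 0) p (mk 1 0) + polyMul (mk 1 0) q (mk 0 1) := by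
  simp [polyMul_mk, mk_add]

/-- Graded commutativity gives `t t = -t t`, and `2` is invertible. -/
theorem odd_mul_self [CharZero K] {S : CDGA K} {t : S.carrier} (ht : t ∈ S.gr 1) : t * t = 0 := by
  have h := S.mul_comm ht ht
  simp only [mul_one, Int.negOnePow_one, Units.val_neg, Units.val_one, neg_smul, one_smul] at h
  have h2 : (2 : K) • (t * t) = 0 := by
    rw [two_smul]
    exact eq_neg_iff_add_eq_zero.1 h
  exact (smul_eq_zero.1 h2).resolve_left two_ne_zero

theorem commute_of_mem_gr {S : CDGA K} {s t : S.carrier} (hs : s ∈ S.gr 0) (ht : t ∈ S.gr 1) :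
    Commute t s :=
  (S.mul_comm ht hs).trans (by simp)

/-- Multiplicativity of `lift`: as `s` is even it commutes with `t`, and the term with two factors
`t` vanishes. -/
theorem polyMul_mul_polyMul [CharZero K] {S : CDGA K} {s t : S.carrier} (hs : s ∈ S.gr 0)
    (ht : t ∈ S.gr 1) (p q p' q' : K[X]) :
    polyMul s (X * p * p') s + polyMul s (X * (p * q' + q * p')) t =
      (polyMul s p s + polyMul s q t) * (polyMul s p' s + polyMul s q' t) := by
  have hst := commute_of_mem_gr hs ht
  rw [add_mul (polyMul s p s), mul_add (polyMul s p s), mul_add (polyMul s q t), mul_add X,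
    polyMul_mul_right, polyMul_mul_right, polyMul_mul_right,
    polyMul_mul_right, mul_polyMul (Commute.refl s), mul_polyMul (Commute.refl s),
    mul_polyMul hst, mul_polyMul hst, odd_mul_self ht, map_zero, map_zero, add_zero,
    ← polyMul_mul, ← polyMul_mul, ← polyMul_mul, mul_assoc, polyMul_X_mul, hst.eq,
    polyMul_add, polyMul_X_mul, polyMul_X_mul, add_assoc]

/-- The morphism that sends `x` to `s` and `e` to `t`. -/
noncomputable def lift [CharZero K] {S : CDGA K} {s t : S.carrier} (hs : s ∈ S.gr 0)
    (ht : t ∈ S.gr 1) (hds : S.d s = 0) (hdt : S.d t = s * s) : (cdga K).Hom S where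
  toFun :=
    { toFun := fun a : KoszulAlgebra K => polyMul s a.1 s + polyMul s a.2 t
      map_smul' := fun c a => by
        change polyMul s (c • a.1) s + polyMul s (c • a.2) t = _
        simp [polyMul]
      map_zero' := by
        change polyMul s 0 s + polyMul s 0 t = _
        simp [polyMul]
      map_add' := fun a b => by
        change polyMul s (a.1 + b.1) s + polyMul s (a.2 + b.2) t = _
        rw [polyMul_add, polyMul_add]
        abel
      map_mul' := fun a b => polyMul_mul_polyMul hs ht a.1 a.2 b.1 b.2 }
  map_gr {i a} ha := by
    change polyMul s (a : KoszulAlgebra K).1 s + polyMul s (a : KoszulAlgebra K).2 t ∈ S.gr i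
    have hm : ∀ (i : ℤ), ∀ x ∈ S.gr i, s * x ∈ S.gr i := fun i x hx => by
      simpa using S.mul_mem hs hx
    obtain ⟨rfl, p, rfl⟩ | ⟨rfl, p, rfl⟩ | rfl := gr_cases ha
    · change polyMul s p s + polyMul s 0 t ∈ _
      rw [polyMul, polyMul, map_zero, LinearMap.zero_apply, add_zero]
      exact polyMul_mem (hm 0) p hs
    · change polyMul s 0 s + polyMul s p t ∈ _
      rw [polyMul, polyMul, map_zero, LinearMap.zero_apply, zero_add]
      exact polyMul_mem (hm 1) p ht
    · change polyMul s 0 s + polyMul s 0 t ∈ _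
      simp [polyMul]
  map_d a := by
    obtain ⟨p, q, rfl⟩ := mk_surjective a
    change polyMul s (X * q) s + polyMul s 0 t = S.d (polyMul s p s + polyMul s q t)
    have hm : ∀ x, S.d (s * x) = s * S.d x := fun x => by
      simp [S.leibniz hs, hds]
    rw [map_add, polyMul_induction s hm, polyMul_induction s hm, hds, hdt, polyMul_X_mul]
    simp [polyMul]

theorem lift_apply [CharZero K] {S : CDGA K} {s t : S.carrier} (hs : s ∈ S.gr 0)
    (ht : t ∈ S.gr 1) (hds : S.d s = 0) (hdt : S.d t = s * s) (p q : K[X]) :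
    (lift hs ht hds hdt).toFun (mk p q) = polyMul s p s + polyMul s q t := rfl

variable (K) in
-- The algebra arises by attaching two cells, `x` with boundary `0` and `e` with boundary `x²`.
-- Their images are lifted one after the other and freeness extends the choice.
theorem isCofibrant [CharZero K] : (cdga K).IsCofibrant := by
  intro S T p g hp
  let G : KoszulAlgebra K →ₙₐ[K] T.carrier := g.toFun
  have hdG : ∀ a, T.d (G a) = G (d K a) := fun a => (g.map_d a).symm
  have hx : G (mk 1 0) ∈ T.gr 0 := g.map_gr (mk_mem_gr_zero 1)
  have he : G (mk 0 1) ∈ T.gr 1 := g.map_gr (mk_mem_gr_one 1)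
  obtain ⟨s, hs, hds, hps⟩ := hp.exists_lift (z := 0) (Submodule.zero_mem _) (map_zero _) hx (by
    rw [hdG, d_mk, mul_zero, mk_zero, map_zero, map_zero])
  -- The boundary of the lift of `e` is prescribed by the lift `s` already chosen for `x`.
  obtain ⟨t, ht, hdt, hpt⟩ := hp.exists_lift (z := s * s) (by simpa using S.mul_mem hs hs) (by
    simp [S.leibniz hs, hds]) he (by
    rw [hdG, map_mul, hps, ← map_mul, d_mk, mk_mul]
    simp)
  refine ⟨lift hs ht hds hdt, fun a => ?_⟩
  obtain ⟨a, b, rfl⟩ := mk_surjective a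
  have h1 : ∀ (q : K[X]) x, p.toFun (polyMul s q x) = polyMul (G (mk 1 0)) q (p.toFun x) :=
    polyMul_induction s (φ := (p.toFun : S.carrier →ₗ[K] T.carrier)) fun x => by
      change p.toFun (s * x) = _ * p.toFun x
      rw [map_mul, hps]
  have h2 : ∀ (q : K[X]) x, G (polyMul (mk 1 0) q x) = polyMul (G (mk 1 0)) q (G x) :=
    polyMul_induction (mk 1 0) (φ := (G : KoszulAlgebra K →ₗ[K] T.carrier)) fun x =>
      map_mul G (mk 1 0) x
  rw [lift_apply, map_add, h1, h1, hps, hpt]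
  change _ = G (mk a b)
  rw [mk_eq_polyMul a b, map_add, h2, h2]

variable (K) in
/-- The augmentation to the one-dimensional algebra with zero multiplication. -/
noncomputable def ε : KoszulAlgebra K →ₙₐ[K] NullAlgebra K where
  toFun a := (a.1.coeff 0 : K)
  map_smul' c a := Polynomial.coeff_smul c a.1 0
  map_zero' := rfl
  map_add' a b := Polynomial.coeff_add a.1 b.1 0
  map_mul' a b := by
    change (X * a.1 * b.1).coeff 0 = (0 : K)
    simp [mul_assoc]

theorem ε_mk (p q : K[X]) : ε K (mk p q) = p.coeff 0 • NullAlgebra.gen K :=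
  NullAlgebra.eq_smul_gen _

variable (K) in
/-- The Koszul algebra resolves the one-dimensional algebra with zero multiplication. -/
noncomputable def resolution [CharZero K] : Resolution K (NullAlgebra K) where
  R := cdga K
  ε := ε K
  ε_gr {i} hi a ha := by
    obtain ⟨rfl, p, rfl⟩ | ⟨rfl, p, rfl⟩ | rfl := gr_cases ha
    · exact absurd rfl hi
    · rfl
    · rfl
  ε_d a := by
    change ε K (d K a) = 0
    obtain ⟨p, q, rfl⟩ := mk_surjective a
    rw [d_mk, ε_mk]
    simp
  cofibrant := isCofibrant K
  injective_homology a hda ha := by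
    obtain ⟨p, q, rfl⟩ := mk_surjective a
    change d K (mk p q) = 0 at hda
    rw [d_mk, ← mk_zero, mk_inj] at hda
    -- A cycle has `q = 0`, and if the augmentation kills `x p` then `p = X r`. So the cycle is `x²
    -- r = d(r e)`.
    obtain ⟨r, rfl⟩ := X_dvd_iff.2 (show p.coeff 0 = 0 from ha)
    refine ⟨mk 0 r, ?_⟩
    change d K (mk 0 r) = _
    rw [d_mk, mk_inj]
    exact ⟨rfl, ((mul_eq_zero_iff_left X_ne_zero).1 hda.1).symm⟩
  surjective_homology := fun (c : K) => by
    refine ⟨mk (C c) 0, ?_, coeff_C_zero (R := K)⟩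
    change d K _ = 0
    rw [d_mk, mul_zero, mk_zero]

end KoszulAlgebra

end KoszulAlgebra

/-! ### Functoriality of the cotangent complex in the resolution. -/

section Derivations

namespace Resolution

variable {K : Type u} [Field K] {A : Type u} [NonUnitalCommRing A] [Module K A]
  [IsScalarTower K A A] [SMulCommClass K A A] (P P' : Resolution K A)

theorem δ_add (r s : P.R.carrier) : P.δ (r + s) = P.δ r + P.δ s := by
  simp only [δ, TensorProduct.tmul_add]
  rfl

theorem δ_smul (c : K) (r : P.R.carrier) :
    P.δ (c • r) = algebraMap K (Unitization K A) c • P.δ r := by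
  simp only [δ, ← Submodule.Quotient.mk_smul, TensorProduct.smul_tmul', smul_eq_mul, mul_one,
    ← TensorProduct.smul_tmul, Algebra.algebraMap_eq_smul_one]

theorem δ_zero : P.δ 0 = 0 := by
  simp only [δ, TensorProduct.tmul_zero]
  rfl

/-- The Leibniz rule carries no sign here: `ε s` vanishes unless `s` has degree `0`, and then the
sign is `1`. -/
theorem δ_mul {i j : ℤ} {r s : P.R.carrier} (hr : r ∈ P.R.gr i) (hs : s ∈ P.R.gr j) :
    P.δ (r * s) = (P.ε r : Unitization K A) • P.δ s + (P.ε s : Unitization K A) • P.δ r := by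
  have h : (1 ⊗ₜ (r * s) - (P.ε r : Unitization K A) ⊗ₜ s
      - ((i * j).negOnePow : ℤ) • ((P.ε s : Unitization K A) ⊗ₜ r)) ∈ P.relations :=
    Submodule.subset_span ⟨i, j, r, s, hr, hs, rfl⟩
  rw [TensorProduct.smul_tmul', P.negOnePow_smul_ε i hs, sub_sub] at h
  refine ((Submodule.Quotient.eq _).2 h).trans ?_
  simp only [δ, ← Submodule.Quotient.mk_smul, TensorProduct.smul_tmul', smul_eq_mul, mul_one]
  rfl

theorem diff_induction {N : Submodule (Unitization K A) P.Diff} (h : ∀ r, P.δ r ∈ N) : N = ⊤ := by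
  rw [eq_top_iff]
  rintro x -
  obtain ⟨t, rfl⟩ := Submodule.mkQ_surjective _ x
  induction t using TensorProduct.induction_on with
  | zero => rw [map_zero]; exact N.zero_mem
  | add a b ha hb => rw [map_add]; exact N.add_mem ha hb
  | tmul b r =>
    have : b ⊗ₜ[K] r = b • (1 ⊗ₜ[K] r) := by
      rw [TensorProduct.smul_tmul', smul_eq_mul, mul_one]
    rw [this, map_smul]
    exact N.smul_mem b (h r)

variable {P P'}

theorem diff_hom_ext {N : Type*} [AddCommGroup N] [Module (Unitization K A) N]
    {φ ψ : P.Diff →ₗ[Unitization K A] N} (h : ∀ r, φ (P.δ r) = ψ (P.δ r)) : φ = ψ :=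
  LinearMap.eqLocus_eq_top.1 (P.diff_induction (N := LinearMap.eqLocus φ ψ) h)

/-- The linear map on differential forms that corresponds to a derivation. -/
noncomputable def liftDerivation {N : Type*} [AddCommGroup N] [Module K N]
    [Module (Unitization K A) N] [IsScalarTower K (Unitization K A) N] (D : P.R.carrier →ₗ[K] N)
    (hD : ∀ (i j : ℤ), ∀ r ∈ P.R.gr i, ∀ s ∈ P.R.gr j,
      D (r * s) = (P.ε r : Unitization K A) • D s + (P.ε s : Unitization K A) • D r) :
    P.Diff →ₗ[Unitization K A] N :=
  P.relations.liftQ (LinearMap.liftBaseChange (Unitization K A) D) <| by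
    rw [relations, Submodule.span_le]
    rintro _ ⟨i, j, r, s, hr, hs, rfl⟩
    rw [TensorProduct.smul_tmul', P.negOnePow_smul_ε i hs]
    simp [hD i j r hr s hs]

theorem liftDerivation_δ {N : Type*} [AddCommGroup N] [Module K N]
    [Module (Unitization K A) N] [IsScalarTower K (Unitization K A) N] (D : P.R.carrier →ₗ[K] N)
    (hD : ∀ (i j : ℤ), ∀ r ∈ P.R.gr i, ∀ s ∈ P.R.gr j,
      D (r * s) = (P.ε r : Unitization K A) • D s + (P.ε s : Unitization K A) • D r)
    (r : P.R.carrier) : P.liftDerivation D hD (P.δ r) = D r := by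
  change LinearMap.liftBaseChange (Unitization K A) D (1 ⊗ₜ r) = D r
  simp

/-- The map on differential forms induced by a morphism of resolutions. -/
noncomputable def diffMap (g : P.R.Hom P'.R) (hg : ∀ a, P'.ε (g.toFun a) = P.ε a) :
    P.Diff →ₗ[Unitization K A] P'.Diff :=
  P.liftDerivation
    { toFun := fun r => P'.δ (g.toFun r)
      map_add' := fun r s => by rw [map_add, δ_add]
      map_smul' := fun c r => by
        rw [map_smul, δ_smul, algebraMap_smul]
        rfl }
    fun i j r hr s hs => by
      change P'.δ (g.toFun (r * s)) = _ • P'.δ (g.toFun s) + _ • P'.δ (g.toFun r)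
      rw [map_mul, P'.δ_mul (g.map_gr hr) (g.map_gr hs), hg, hg]

theorem diffMap_δ (g : P.R.Hom P'.R) (hg : ∀ a, P'.ε (g.toFun a) = P.ε a) (r : P.R.carrier) :
    diffMap g hg (P.δ r) = P'.δ (g.toFun r) :=
  liftDerivation_δ _ _ r

theorem diffMap_diffD (g : P.R.Hom P'.R) (hg : ∀ a, P'.ε (g.toFun a) = P.ε a) (x : P.Diff) :
    diffMap g hg (P.diffD x) = P'.diffD (diffMap g hg x) := by
  have h : diffMap g hg ∘ₗ P.diffD = P'.diffD ∘ₗ diffMap g hg := diff_hom_ext fun r => by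
    rw [LinearMap.comp_apply, LinearMap.comp_apply, diffD_δ, diffMap_δ, diffMap_δ, diffD_δ, g.map_d]
  exact LinearMap.congr_fun h x

theorem diffMap_mem (g : P.R.Hom P'.R) (hg : ∀ a, P'.ε (g.toFun a) = P.ε a) (i : ℤ) :
    ∀ x ∈ P.diffGr i, diffMap g hg x ∈ P'.diffGr i := by
  change P.diffGr i ≤ (P'.diffGr i).comap (diffMap g hg)
  rw [diffGr, Submodule.span_le]
  rintro _ ⟨r, hr, rfl⟩
  exact Submodule.subset_span ⟨_, g.map_gr hr, diffMap_δ g hg r⟩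

theorem diffToKaehler_δ (r : P.R.carrier) : P.diffToKaehler (P.δ r) =
    KaehlerDifferential.D K (Unitization K A) (Unitization.inr (P.ε r)) := by
  change (1 : Unitization K A) • KaehlerDifferential.D K (Unitization K A)
    (Unitization.inr (P.ε r)) = _
  rw [one_smul]

theorem diffToKaehler_diffMap (g : P.R.Hom P'.R) (hg : ∀ a, P'.ε (g.toFun a) = P.ε a)
    (x : P.Diff) : P'.diffToKaehler (diffMap g hg x) = P.diffToKaehler x := by
  have h : P'.diffToKaehler ∘ₗ diffMap g hg = P.diffToKaehler := diff_hom_ext fun r => by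
    rw [LinearMap.comp_apply, diffMap_δ, diffToKaehler_δ, diffToKaehler_δ, hg]
  exact LinearMap.congr_fun h x

/-- The map of cotangent complexes induced by a morphism of resolutions. -/
noncomputable def cotangentMap (g : P.R.Hom P'.R) (hg : ∀ a, P'.ε (g.toFun a) = P.ε a) :
    P.cotangentComplex ⟶ P'.cotangentComplex where
  f n := ModuleCat.ofHom ((diffMap g hg).restrict (diffMap_mem g hg (-n)))
  comm' i j hij := by
    rw [show P.cotangentComplex.d i j = _ from dif_pos hij,
      show P'.cotangentComplex.d i j = _ from dif_pos hij]
    refine ModuleCat.hom_ext (LinearMap.ext fun x => Subtype.ext ?_)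
    exact (diffMap_diffD g hg x.1).symm

variable (P) in
/-- The degree zero component of the map from the cotangent complex to the Kähler differentials. -/
noncomputable def cotangentZeroToKaehler : P.cotangentComplex.X 0 ⟶ kaehler K A :=
  ModuleCat.ofHom (P.diffToKaehler ∘ₗ (P.diffGr (-0)).subtype)

variable (P) in
theorem cotangentToKaehler_f : P.cotangentToKaehler.f 0 = P.cotangentZeroToKaehler ≫
    (HomologicalComplex.singleObjXSelf (ComplexShape.up ℤ) 0 (kaehler K A)).inv :=
  HomologicalComplex.mkHomToSingle_f _ _

/-- The map to the Kähler differentials depends on a resolution only through its augmentation, which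
a morphism over `A` preserves. -/
theorem cotangentMap_comp (g : P.R.Hom P'.R) (hg : ∀ a, P'.ε (g.toFun a) = P.ε a) :
    cotangentMap g hg ≫ P'.cotangentToKaehler = P.cotangentToKaehler := by
  apply HomologicalComplex.to_single_hom_ext
  rw [HomologicalComplex.comp_f, cotangentToKaehler_f, cotangentToKaehler_f, ← Category.assoc]
  congr 1
  refine ModuleCat.hom_ext (LinearMap.ext fun x => ?_)
  exact diffToKaehler_diffMap g hg (Subtype.val x)

variable (P) in
/-- The augmentation, as an acyclic fibration. -/
def augmentation : P.R.Hom (CDGA.ofAlgebra K A) where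
  toFun := P.ε
  map_gr {i a} ha := by
    change P.ε a ∈ twoStepGrading (⊤ : Submodule K A) ⊥ i
    by_cases h : i = 0
    · subst h
      exact Submodule.mem_top
    · rw [P.ε_gr h ha]
      exact Submodule.zero_mem _
  map_d a := P.ε_d a

variable (P) in
theorem isAcyclicFibration_augmentation : P.augmentation.IsAcyclicFibration where
  surjective x := by
    obtain ⟨a, -, h⟩ := P.surjective_homology x
    exact ⟨a, h⟩
  injective_homology a ha := by
    rintro ⟨b, hb⟩
    exact P.injective_homology a ha hb.symm
  surjective_homology b _ := by
    obtain ⟨a, ha, h⟩ := P.surjective_homology b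
    exact ⟨a, ha, 0, sub_eq_zero.2 h⟩

variable (P P') in
-- The augmentation of `P'` is an acyclic fibration onto `A` in degree `0`, and the cofibrant `P.R`
-- lifts its own augmentation through it.
theorem exists_hom : ∃ g : P.R.Hom P'.R, ∀ a, P'.ε (g.toFun a) = P.ε a :=
  P.cofibrant _ _ P'.augmentation P.augmentation P'.isAcyclicFibration_augmentation

end Resolution

end Derivations

/-! ### Vanishing in the derived category and a non-vanishing Ext class. -/

section Homological

open Abelian

universe w v w'

/-- Morphisms in the derived category from a bounded above complex of projective objects to a shifted
object vanish if the complex vanishes in the relevant degree. -/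
theorem derivedHom_single_eq_zero {C : Type w'} [Category.{v} C] [Abelian C]
    [HasDerivedCategory.{w} C] (L : CochainComplex C ℤ) (d : ℤ) [L.IsStrictlyLE d]
    [∀ n, Projective (L.X n)] (M : C) (n : ℤ) (h : Limits.IsZero (L.X (-n)))
    (φ : ShiftedHom (DerivedCategory.Q.obj L) ((DerivedCategory.singleFunctor C 0).obj M) n) :
    φ = 0 := by
  have := CochainComplex.isKProjective_of_projective L d
  -- Trade the shift by `n` for the placement of `M` in degree `-n`, so that the target is the image
  -- of an actual complex.
  rw [← cancel_mono (((DerivedCategory.singleFunctors C).shiftIso n (-n) 0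
    (by lia)).hom.app M), Limits.zero_comp]
  generalize φ ≫ ((DerivedCategory.singleFunctors C).shiftIso n (-n) 0 (by lia)).hom.app M = ψ
  let N : CochainComplex C ℤ := (CochainComplex.singleFunctor C (-n)).obj M
  change DerivedCategory.Q.obj L ⟶ DerivedCategory.Q.obj N at ψ
  change ψ = 0
  -- As `L` is K-projective, the morphism is represented by a chain map. A chain map into a complex
  -- concentrated in degree `-n` is given by its component there, whose source is zero.
  obtain ⟨g, hg⟩ := (CochainComplex.IsKProjective.Qh_map_bijective L
    ((HomotopyCategory.quotient C (.up ℤ)).obj N)).surjective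
    ((DerivedCategory.quotientCompQhIso C).hom.app L ≫ ψ ≫
      (DerivedCategory.quotientCompQhIso C).inv.app N)
  obtain ⟨g, rfl⟩ := (HomotopyCategory.quotient _ _).map_surjective g
  have hg0 : g = 0 := by
    apply HomologicalComplex.to_single_hom_ext
    exact h.eq_of_src _ _
  rw [hg0, Functor.map_zero, Functor.map_zero, eq_comm, Preadditive.IsIso.comp_left_eq_zero,
    Preadditive.IsIso.comp_right_eq_zero] at hg
  exact hg

/-- Used with `L₁` the cotangent complex of any resolution, `L₂` that of the Koszul resolution and
`L₃` the Kähler differentials. -/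
theorem derivedMap_comp_eq_zero {C : Type w'} [Category.{v} C] [Abelian C]
    [HasDerivedCategory.{w} C] {L₁ L₂ L₃ : CochainComplex C ℤ} {f : L₁ ⟶ L₂} {g : L₂ ⟶ L₃}
    {h : L₁ ⟶ L₃} (hfg : f ≫ g = h) {Z : DerivedCategory C}
    (hZ : ∀ φ : DerivedCategory.Q.obj L₂ ⟶ Z, φ = 0) (ψ : DerivedCategory.Q.obj L₃ ⟶ Z) :
    DerivedCategory.Q.map h ≫ ψ = 0 := by
  rw [← hfg, Functor.map_comp, Category.assoc, hZ (_ ≫ ψ), Limits.comp_zero]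

/-- An object that is isomorphic to its own syzygy without being projective has a non-zero
self-extension in degree two. -/
theorem exists_ext_two_ne_zero {C : Type w'} [Category.{v} C] [Abelian C] [HasExt.{w} C]
    {X Y : C} [Projective Y] {f : X ⟶ Y} {g : Y ⟶ X} (hfg : f ≫ g = 0)
    (hS : (ShortComplex.mk f g hfg).ShortExact) (hf : ¬ IsSplitMono f) :
    ∃ e : Ext X X 2, e ≠ 0 := by
  -- The witness is the Yoneda square of the extension class. If it vanishes, the class comes from
  -- `Ext¹(Y, X) = 0`, so it is zero. Then the identity of `X` extends along `f`, which is a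
  -- splitting.
  refine ⟨hS.extClass.comp hS.extClass rfl, fun h => hf ?_⟩
  obtain ⟨x, hx⟩ := Ext.contravariant_sequence_exact₁ hS X hS.extClass rfl h
  have h0 : hS.extClass = 0 := by
    rw [← hx, show x = 0 from Ext.eq_zero_of_projective x, Ext.comp_zero]
  obtain ⟨y, hy⟩ := Ext.contravariant_sequence_exact₁ hS X (Ext.mk₀ (𝟙 X)) rfl
    (by rw [h0, Ext.zero_comp])
  obtain ⟨r, rfl⟩ := Ext.homEquiv₀.symm.surjective y
  refine ⟨⟨r, ?_⟩⟩
  apply (Ext.mk₀_bijective X X).injective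
  rw [← hy, ← Ext.mk₀_comp_mk₀]
  rfl

end Homological

/-- A functional with value `1` at `x` shows that `x` has no annihilator, so its span is free of
rank one. -/
theorem projective_span_singleton {R M : Type*} [Ring R] [AddCommGroup M] [Module R M] (x : M)
    (φ : M →ₗ[R] R) (h : φ x = 1) : Module.Projective R (Submodule.span R {x}) := by
  have hi : Function.Injective (LinearMap.toSpanSingleton R M x) := fun a b hab => by
    simpa [h] using congrArg φ hab
  rw [← LinearMap.range_toSpanSingleton]
  exact Module.Projective.of_equiv (LinearEquiv.ofInjective _ hi)

/-! ### The dual numbers and their Kähler differentials. -/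

namespace NullAlgebra

variable (K : Type u) [Field K]

/-- The generator, as an element of the enveloping algebra. -/
def genU : Unitization K (NullAlgebra K) := Unitization.inr (gen K)

variable {K}

theorem genU_mul_genU : genU K * genU K = 0 := by
  rw [genU, ← Unitization.inr_mul, mul_eq_zero, Unitization.inr_zero]

theorem inr_eq (a : NullAlgebra K) :
    ∃ c : K, (Unitization.inr a : Unitization K (NullAlgebra K)) = c • genU K :=
  ⟨(show K from a), by rw [genU, ← Unitization.inr_smul, ← eq_smul_gen]⟩

theorem mul_genU (b : Unitization K (NullAlgebra K)) : b * genU K = b.fst • genU K := by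
  refine Unitization.ext ?_ ?_ <;> simp [genU]

theorem genU_ne_zero : genU K ≠ 0 := fun h =>
  one_ne_zero (α := K) (Unitization.inr_injective (h.trans (Unitization.inr_zero K).symm))

theorem fst_eq_zero {b : Unitization K (NullAlgebra K)} (h : b * genU K = 0) : b.fst = 0 := by
  rw [mul_genU] at h
  exact (smul_eq_zero.1 h).resolve_right genU_ne_zero

/-- Only the constant term survives since `x² = 0`. This expresses the action through `ε` as
evaluation of `x p(x)`. -/
theorem genU_mul_aeval (p : Polynomial K) : genU K * Polynomial.aeval (genU K) p =
    Unitization.inr (p.coeff 0 • gen K) := by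
  induction p using Polynomial.induction_on with
  | C a =>
    rw [Polynomial.aeval_C, Polynomial.coeff_C_zero, Algebra.algebraMap_eq_smul_one, mul_smul_comm,
      mul_one, Unitization.inr_smul, genU]
  | add p q hp hq =>
    rw [map_add, mul_add, hp, hq, Polynomial.coeff_add, add_smul, Unitization.inr_add]
  | monomial n a _ =>
    rw [pow_succ', mul_left_comm, map_mul, Polynomial.aeval_X, ← mul_assoc, genU_mul_genU,
      zero_mul]
    simp

section Kaehler

open KaehlerDifferential

variable (K) in
/-- The derivation that is zero on constants and the identity on the algebra. -/
noncomputable def derivation :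
    Derivation K (Unitization K (NullAlgebra K)) (Unitization K (NullAlgebra K)) :=
  Derivation.mk' ((Unitization.inrHom K K (NullAlgebra K)) ∘ₗ
      (Unitization.sndHom K K (NullAlgebra K))) fun a b => by
    change Unitization.inr (a * b).snd = a * Unitization.inr b.snd + b * Unitization.inr a.snd
    refine Unitization.ext ?_ ?_ <;> simp

variable (K) in
/-- The embedding of the Kähler differentials of the enveloping algebra. -/
noncomputable def kaehlerToSelf :
    Ω[Unitization K (NullAlgebra K)⁄K] →ₗ[Unitization K (NullAlgebra K)]
      Unitization K (NullAlgebra K) :=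
  (derivation K).liftKaehlerDifferential

theorem kaehlerToSelf_D (b : Unitization K (NullAlgebra K)) :
    kaehlerToSelf K (D K _ b) = Unitization.inr b.snd :=
  Derivation.liftKaehlerDifferential_comp_D _ _

variable (K) in
/-- The map that sends `1` to the differential of the generator. -/
noncomputable def selfToKaehler : Unitization K (NullAlgebra K) →ₗ[Unitization K (NullAlgebra K)]
    Ω[Unitization K (NullAlgebra K)⁄K] :=
  LinearMap.toSpanSingleton _ _ (D K _ (genU K))

theorem selfToKaehler_apply (b : Unitization K (NullAlgebra K)) :
    selfToKaehler K b = b • D K _ (genU K) := rfl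

/-- `0 = D(x²) = 2 x D x`, and `2` is invertible. -/
theorem genU_smul_D [CharZero K] : genU K • D K _ (genU K) = 0 := by
  have h := (D K (Unitization K (NullAlgebra K))).leibniz (genU K) (genU K)
  rw [genU_mul_genU, map_zero, ← two_smul K] at h
  exact (smul_eq_zero.1 h.symm).resolve_left two_ne_zero

theorem inr_smul_D [CharZero K] (a : NullAlgebra K) :
    (Unitization.inr a : Unitization K (NullAlgebra K)) • D K _ (genU K) = 0 := by
  obtain ⟨c, hc⟩ := inr_eq a
  rw [hc, smul_assoc, genU_smul_D, smul_zero]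

theorem selfToKaehler_surjective : Function.Surjective (selfToKaehler K) := by
  rw [← LinearMap.range_eq_top, eq_top_iff, ← span_range_derivation, Submodule.span_le]
  rintro _ ⟨b, rfl⟩
  obtain ⟨c, hc⟩ := inr_eq b.snd
  refine ⟨algebraMap K _ c, ?_⟩
  rw [selfToKaehler_apply, algebraMap_smul, ← Derivation.map_smul, ← hc]
  conv_rhs => rw [← Unitization.inl_fst_add_inr_snd_eq b, map_add]
  rw [← Unitization.algebraMap_eq_inl, Derivation.map_algebraMap, zero_add]

/-- Every form is `b dx` and goes to `b x`. If this is zero, the scalar part of `b` vanishes, and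
the rest of `b` kills `dx`. -/
theorem kaehlerToSelf_injective [CharZero K] : Function.Injective (kaehlerToSelf K) := by
  rw [injective_iff_map_eq_zero]
  intro ω h
  obtain ⟨b, rfl⟩ := selfToKaehler_surjective ω
  rw [selfToKaehler_apply, map_smul, kaehlerToSelf_D] at h
  have h0 := fst_eq_zero (b := b) h
  rw [selfToKaehler_apply, ← Unitization.inl_fst_add_inr_snd_eq b, h0, Unitization.inl_zero,
    zero_add, inr_smul_D]

theorem selfToKaehler_kaehlerToSelf [CharZero K] (ω : Ω[Unitization K (NullAlgebra K)⁄K]) :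
    selfToKaehler K (kaehlerToSelf K ω) = 0 := by
  obtain ⟨b, rfl⟩ := selfToKaehler_surjective ω
  rw [selfToKaehler_apply, selfToKaehler_apply, map_smul, kaehlerToSelf_D, smul_assoc, inr_smul_D,
    smul_zero]

/-- Exactness in the middle: `b dx = 0` gives `b x = 0`, so `b` lies in `A` and is the image of `D
b`. -/
theorem mem_range_kaehlerToSelf {b : Unitization K (NullAlgebra K)} (h : selfToKaehler K b = 0) :
    ∃ ω, kaehlerToSelf K ω = b := by
  have h1 := congrArg (kaehlerToSelf K) h
  rw [selfToKaehler_apply, map_smul, kaehlerToSelf_D, map_zero] at h1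
  have h0 := fst_eq_zero (b := b) h1
  refine ⟨D K _ b, ?_⟩
  rw [kaehlerToSelf_D]
  conv_rhs => rw [← Unitization.inl_fst_add_inr_snd_eq b, h0, Unitization.inl_zero, zero_add]

theorem exists_kaehler_ext_two_ne_zero (K : Type u) [Field K] [CharZero K] :
    ∃ e : Abelian.Ext (Resolution.kaehler K (NullAlgebra K))
      (Resolution.kaehler K (NullAlgebra K)) 2, e ≠ 0 := by
  let f : Resolution.kaehler K (NullAlgebra K) ⟶
    ModuleCat.of (Unitization K (NullAlgebra K)) (Unitization K (NullAlgebra K)) :=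
    ModuleCat.ofHom (kaehlerToSelf K)
  let g : ModuleCat.of (Unitization K (NullAlgebra K)) (Unitization K (NullAlgebra K)) ⟶
    Resolution.kaehler K (NullAlgebra K) := ModuleCat.ofHom (selfToKaehler K)
  have hfg : f ≫ g = 0 := ModuleCat.hom_ext (LinearMap.ext selfToKaehler_kaehlerToSelf)
  have hp : Projective (ModuleCat.of (Unitization K (NullAlgebra K))
      (Unitization K (NullAlgebra K))) :=
    (IsProjective.iff_projective _).1 inferInstance
  refine exists_ext_two_ne_zero (hfg := hfg) ?_ ?_
  · have hf : Mono f := (ModuleCat.mono_iff_injective f).2 kaehlerToSelf_injective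
    have hg : Epi g := (ModuleCat.epi_iff_surjective g).2 selfToKaehler_surjective
    refine ⟨?_⟩
    rw [ShortComplex.moduleCat_exact_iff]
    exact fun b hb => mem_range_kaehlerToSelf hb
  -- A retraction `r` would give `dx = r(x) = x r(1)`. This is zero because `x` kills all forms,
  -- although `dx` has the nonzero image `x`.
  · rintro ⟨⟨r, hr⟩⟩
    have h1 := LinearMap.congr_fun (congrArg ModuleCat.Hom.hom hr) (D K _ (genU K))
    change r.hom (kaehlerToSelf K (D K _ (genU K))) = D K _ (genU K) at h1
    have h2 : kaehlerToSelf K (D K _ (genU K)) = genU K • 1 := by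
      rw [kaehlerToSelf_D, smul_eq_mul, mul_one]
      rfl
    obtain ⟨b, hb⟩ := selfToKaehler_surjective (r.hom 1)
    rw [h2, map_smul, ← hb, selfToKaehler_apply, smul_comm, genU_smul_D, smul_zero] at h1
    rw [← h1, map_zero, smul_eq_mul, mul_one] at h2
    exact genU_ne_zero h2.symm

end Kaehler

end NullAlgebra

/-! ### The cotangent complex of the Koszul resolution and the conclusion. -/

namespace KoszulAlgebra

open Polynomial NullAlgebra

variable (K : Type u) [Field K]

/-- The derivation `∂ / ∂x`, with values in the enveloping algebra. -/
noncomputable def derivX : KoszulAlgebra K →ₗ[K] Unitization K (NullAlgebra K) :=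
  (aeval (genU K)).toLinearMap ∘ₗ derivative ∘ₗ LinearMap.mulLeft K X ∘ₗ LinearMap.fst K K[X] K[X]

/-- The derivation `∂ / ∂e`, with values in the enveloping algebra. -/
noncomputable def derivE : KoszulAlgebra K →ₗ[K] Unitization K (NullAlgebra K) :=
  (aeval (genU K)).toLinearMap ∘ₗ LinearMap.snd K K[X] K[X]

theorem derivX_mk (p q : K[X]) : derivX K (mk p q) = aeval (genU K) (derivative (X * p)) := rfl

theorem derivE_mk (p q : K[X]) : derivE K (mk p q) = aeval (genU K) q := rfl

/-- Evaluating the even part `x p(x)` at the generator gives the augmentation, so this is the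
product rule for the polynomials `x p` and `x p'`. -/
theorem derivX_mul (a b : KoszulAlgebra K) : derivX K (a * b) =
    (Unitization.inr (ε K a) : Unitization K (NullAlgebra K)) • derivX K b +
      (Unitization.inr (ε K b) : Unitization K (NullAlgebra K)) • derivX K a := by
  obtain ⟨p, q, rfl⟩ := mk_surjective a
  obtain ⟨p', q', rfl⟩ := mk_surjective b
  rw [mk_mul, derivX_mk, derivX_mk, derivX_mk,
    show X * (X * p * p') = (X * p) * (X * p') by ring, derivative_mul, ε_mk, ε_mk,
    ← genU_mul_aeval, ← genU_mul_aeval, smul_eq_mul, smul_eq_mul, map_add,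
    map_mul (aeval (genU K)) (derivative (X * p)), map_mul (aeval (genU K)) (X * p),
    map_mul (aeval (genU K)) X p, map_mul (aeval (genU K)) X p', aeval_X]
  ring

theorem derivE_mul (a b : KoszulAlgebra K) : derivE K (a * b) =
    (Unitization.inr (ε K a) : Unitization K (NullAlgebra K)) • derivE K b +
      (Unitization.inr (ε K b) : Unitization K (NullAlgebra K)) • derivE K a := by
  obtain ⟨p, q, rfl⟩ := mk_surjective a
  obtain ⟨p', q', rfl⟩ := mk_surjective b
  rw [mk_mul, derivE_mk, derivE_mk, derivE_mk, ε_mk, ε_mk, ← genU_mul_aeval, ← genU_mul_aeval,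
    smul_eq_mul, smul_eq_mul, map_mul, map_add, map_mul, map_mul, aeval_X]
  ring

variable [CharZero K]

/-- The coefficient of `δ x` of a differential form. -/
noncomputable def coeffX : (resolution K).Diff →ₗ[Unitization K (NullAlgebra K)]
    Unitization K (NullAlgebra K) :=
  Resolution.liftDerivation (P := resolution K) (derivX K) fun _ _ a _ b _ => derivX_mul K a b

/-- The coefficient of `δ e` of a differential form. -/
noncomputable def coeffE : (resolution K).Diff →ₗ[Unitization K (NullAlgebra K)]
    Unitization K (NullAlgebra K) :=
  Resolution.liftDerivation (P := resolution K) (derivE K) fun _ _ a _ b _ => derivE_mul K a b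

theorem coeffX_δ : coeffX K ((resolution K).δ (mk 1 0)) = 1 := by
  refine (Resolution.liftDerivation_δ (P := resolution K) _ _ (mk 1 0)).trans
    ((derivX_mk K 1 0).trans ?_)
  simp

theorem coeffE_δ : coeffE K ((resolution K).δ (mk 0 1)) = 1 := by
  refine (Resolution.liftDerivation_δ (P := resolution K) _ _ (mk 0 1)).trans
    ((derivE_mk K 0 1).trans ?_)
  rw [map_one]

/-- The universal derivation. -/
noncomputable abbrev δ (a : KoszulAlgebra K) : (resolution K).Diff := (resolution K).δ a

theorem δ_mul {i j : ℤ} {a b : KoszulAlgebra K} (ha : a ∈ gr K i) (hb : b ∈ gr K j) :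
    δ K (a * b) = (Unitization.inr (ε K a) : Unitization K (NullAlgebra K)) • δ K b +
      (Unitization.inr (ε K b) : Unitization K (NullAlgebra K)) • δ K a :=
  (resolution K).δ_mul ha hb

theorem δ_add (a b : KoszulAlgebra K) : δ K (a + b) = δ K a + δ K b := (resolution K).δ_add a b

theorem δ_smul (c : K) (a : KoszulAlgebra K) :
    δ K (c • a) = algebraMap K (Unitization K (NullAlgebra K)) c • δ K a :=
  (resolution K).δ_smul c a

/-- Induction on the degree, by the Leibniz rule for `x · x^n`. -/
theorem δ_even_mem (p : K[X]) : δ K (mk p 0) ∈ Submodule.span (Unitization K (NullAlgebra K))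
    {δ K (mk 1 0)} := by
  have h1 := Submodule.mem_span_singleton_self (R := Unitization K (NullAlgebra K)) (δ K (mk 1 0))
  induction p using Polynomial.induction_on with
  | C a =>
    rw [show mk (C a) 0 = a • mk (1 : K[X]) 0 by simp [smul_mk, smul_eq_C_mul], δ_smul]
    exact Submodule.smul_mem _ _ h1
  | add p q hp hq =>
    rw [show mk (p + q) 0 = mk p 0 + mk q 0 by simp [mk_add], δ_add]
    exact Submodule.add_mem _ hp hq
  | monomial n a ih =>
    rw [show mk (C a * X ^ (n + 1)) 0 = mk (1 : K[X]) 0 * mk (C a * X ^ n) 0 by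
      rw [mk_mul, mk_inj]; constructor <;> ring, δ_mul K (mk_mem_gr_zero _) (mk_mem_gr_zero _)]
    exact Submodule.add_mem _ (Submodule.smul_mem _ _ ih) (Submodule.smul_mem _ _ h1)

theorem δ_odd_mem (q : K[X]) : δ K (mk 0 q) ∈ Submodule.span (Unitization K (NullAlgebra K))
    {δ K (mk 0 1)} := by
  induction q using Polynomial.induction_on with
  | C a =>
    rw [show mk 0 (C a) = a • mk 0 (1 : K[X]) by simp [smul_mk, smul_eq_C_mul], δ_smul]
    exact Submodule.smul_mem _ _ (Submodule.mem_span_singleton_self _)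
  | add p q hp hq =>
    rw [show mk 0 (p + q) = mk 0 p + mk 0 q by simp [mk_add], δ_add]
    exact Submodule.add_mem _ hp hq
  | monomial n a ih =>
    -- In the Leibniz rule the term with `δ x` drops out, because the augmentation kills multiples
    -- of `e`.
    rw [show mk 0 (C a * X ^ (n + 1)) = mk (1 : K[X]) 0 * mk 0 (C a * X ^ n) by
      rw [mk_mul, mk_inj]; constructor <;> ring, δ_mul K (mk_mem_gr_zero _) (mk_mem_gr_one _),
      ε_mk, ε_mk, coeff_zero, zero_smul, Unitization.inr_zero, zero_smul, add_zero]
    exact Submodule.smul_mem _ _ ih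

theorem diffGr_zero : (resolution K).diffGr 0 =
    Submodule.span (Unitization K (NullAlgebra K)) {δ K (mk 1 0)} := by
  refine le_antisymm (Submodule.span_le.2 ?_) (Submodule.span_le.2 ?_)
  · rintro _ ⟨a, ha, rfl⟩
    obtain ⟨-, p, rfl⟩ | ⟨h, -⟩ | rfl := gr_cases ha
    · exact δ_even_mem K p
    · exact absurd h (by decide)
    · exact δ_even_mem K 0
  · rintro _ rfl
    exact Submodule.subset_span ⟨_, mk_mem_gr_zero 1, rfl⟩

theorem diffGr_one : (resolution K).diffGr 1 =
    Submodule.span (Unitization K (NullAlgebra K)) {δ K (mk 0 1)} := by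
  refine le_antisymm (Submodule.span_le.2 ?_) (Submodule.span_le.2 ?_)
  · rintro _ ⟨a, ha, rfl⟩
    obtain ⟨h, -⟩ | ⟨-, q, rfl⟩ | rfl := gr_cases ha
    · exact absurd h (by decide)
    · exact δ_odd_mem K q
    · exact δ_odd_mem K 0
  · rintro _ rfl
    exact Submodule.subset_span ⟨_, mk_mem_gr_one 1, rfl⟩

theorem diffGr_eq_bot {i : ℤ} (h0 : i ≠ 0) (h1 : i ≠ 1) : (resolution K).diffGr i = ⊥ := by
  rw [eq_bot_iff]
  refine Submodule.span_le.2 ?_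
  rintro _ ⟨a, ha, rfl⟩
  obtain ⟨h, -⟩ | ⟨h, -⟩ | rfl := gr_cases ha
  · exact absurd h h0
  · exact absurd h h1
  · exact (resolution K).δ_zero

theorem isZero_cotangentComplex {n : ℤ} (h0 : n ≠ 0) (h1 : n ≠ -1) :
    Limits.IsZero ((resolution K).cotangentComplex.X n) := by
  have : Subsingleton ((resolution K).diffGr (-n)) := by
    rw [diffGr_eq_bot K (by omega) (by omega)]
    infer_instance
  exact ModuleCat.isZero_of_subsingleton (ModuleCat.of _ ((resolution K).diffGr (-n)))

/-- The nonzero terms are generated by `δ x` and `δ e`; the partial derivatives `coeffX` and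
`coeffE` show that each generates a free module. -/
instance (n : ℤ) : Projective ((resolution K).cotangentComplex.X n) := by
  have : Module.Projective (Unitization K (NullAlgebra K)) ((resolution K).diffGr (-n)) := by
    by_cases h0 : -n = 0
    · rw [h0, diffGr_zero]
      exact projective_span_singleton _ (coeffX K) (coeffX_δ K)
    by_cases h1 : -n = 1
    · rw [h1, diffGr_one]
      exact projective_span_singleton _ (coeffE K) (coeffE_δ K)
    · rw [diffGr_eq_bot K h0 h1]
      infer_instance
  exact (IsProjective.iff_projective ((resolution K).diffGr (-n))).1 this

instance : (resolution K).cotangentComplex.IsStrictlyLE 0 := by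
  rw [CochainComplex.isStrictlyLE_iff]
  exact fun i hi => isZero_cotangentComplex K (by omega) (by omega)

/-- A morphism from `P` to the Koszul resolution factors the comparison map through the maps from a
complex of projectives that is zero in degree `-2`. Having the value at `0` on the right makes the
statement directly applicable against injectivity, as the comparison is only given as a function. -/
theorem extToAndreQuillen_two_eq_zero (P : Resolution K (NullAlgebra K))
    {M : ModuleCat.{u} (Unitization K (NullAlgebra K))}
    (e : Abelian.Ext (Resolution.kaehler K (NullAlgebra K)) M 2) :
    P.extToAndreQuillen M 2 e = P.extToAndreQuillen M 2 0 := by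
  let := HasDerivedCategory.standard (ModuleCat.{u} (Unitization K (NullAlgebra K)))
  obtain ⟨g, hg⟩ := Resolution.exists_hom P (resolution K)
  have key : ∀ e, P.extToAndreQuillen M 2 e = 0 := fun e => by
    exact derivedMap_comp_eq_zero (Resolution.cotangentMap_comp g hg)
      (derivedHom_single_eq_zero (resolution K).cotangentComplex 0 M 2
        (isZero_cotangentComplex K (by decide) (by decide))) e.hom
  rw [key, key]

theorem not_andreQuillenIsExt (P : Resolution K (NullAlgebra K)) : ¬ P.AndreQuillenIsExt :=
  fun h => by
    obtain ⟨e, he⟩ := exists_kaehler_ext_two_ne_zero K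
    exact he ((h _ 2).injective (extToAndreQuillen_two_eq_zero K P e))

end KoszulAlgebra

end ComObstruction

theorem mainTheorem6 (K : Type u) [Field K] [CharZero K] :
    ComObstruction.ObstructionModule.d K 3 0 (ComObstruction.obstructionCycle K) = 0 ∧
    ComObstruction.obstructionCycle K ∉
      LinearMap.range (ComObstruction.ObstructionModule.d K 3 1) ∧
    Nontrivial (ComObstruction.ObstructionH1 K 3) ∧
    ∃ (A : Type u) (_ : NonUnitalCommRing A) (_ : Module K A) (_ : IsScalarTower K A A)
      (_ : SMulCommClass K A A),
      Nonempty (ComObstruction.Resolution K A) ∧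
      ∀ P : ComObstruction.Resolution K A, ¬ P.AndreQuillenIsExt :=
  ⟨ComObstruction.obstructionCycle_isCycle K, ComObstruction.obstructionCycle_notMem_range K,
    ComObstruction.nontrivial_obstructionH1 K, ComObstruction.NullAlgebra K, inferInstance,
    inferInstance, inferInstance, inferInstance, ⟨ComObstruction.KoszulAlgebra.resolution K⟩,
    ComObstruction.KoszulAlgebra.not_andreQuillenIsExt K⟩
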